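/- Let $T>0$, $H\in(1/2,1)$, let $B^1,\dots,B^m$ be fractional Brownian motions with Hurst parameter $H$ (with a.s. continuous paths) on a probability space $(\Omega,\mathcal F,P)$, let $X_0$ be an $\mathbb R^d$-valued random variable, and let $\sigma^{ij},b^i:\Omega\times[0,T]\times\mathbb R^d\to\mathbb R$ ($1\le i\le d$, $1\le j\le m$) be measurable. Write $|y|=\sum_i|y^i|$ for vectors and $|A|=\sum_{i,j}|a^{ij}|$ for matrices. The following conditions on the coefficients are understood for almost every $\omega$, and their constants may depend on $\omega$. (A) $\sigma(t,x)$ is differentiable in $x$, and there exist $M>0$, $1-H<\beta\le1$, $\frac1H-1<\kappa\le1$ and, for every $R>0$, some $M_R>0$ such that 1) $|\sigma(t,x)-\sigma(t,y)|\le M|x-y|$ for $x,y\in\mathbb R^d$, $t\in[0,T]$; 2) $|\partial_{x_i}\sigma(t,x)-\partial_{x_i}\sigma(t,y)|\le M_R|x-y|^\kappa$ for all $i$, $|x|,|y|\le R$, $t\in[0,T]$; 3) $|\sigma(t,x)-\sigma(s,x)|+|\partial_{x_i}\sigma(t,x)-\partial_{x_i}\sigma(s,x)|\le M|t-s|^\beta$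 for all $i$, $x\in\mathbb R^d$, $s,t\in[0,T]$. (B) 1) For every $R>0$ there is $L_R>0$ with $|b(t,x)-b(t,y)|\le L_R|x-y|$ for $|x|,|y|\le R$, $t\in[0,T]$; 2) there is $L$ with $|b(t,x)|\le L(1+|x|)$ for all $t\in[0,T]$, $x\in\mathbb R^d$. (C) There is a constant $K$ with $|\sigma(t,x)|\le K(1+|x|)$ for all $t\in[0,T]$, $x\in\mathbb R^d$. For an integer $N\ge1$ put $\delta=T/N$, $\tau_n=n\delta$, and let $\widetilde Y^{\delta}_{0}=X_0$ and $$\widetilde Y^{i,\delta}_{\tau_{n+1}}=\widetilde Y^{i,\delta}_{\tau_n}+b^i(\tau_n,\widetilde Y^\delta_{\tau_n})\,\delta+\sum_{j=1}^m\sigma^{ij}(\tau_n,\widetilde Y^\delta_{\tau_n})(B^j_{\tau_{n+1}}-B^j_{\tau_n}),$$ $$Y^{i,\delta}_{t}=\widetilde Y^{i,\delta}_{\tau_n}+b^i(\tau_n,\widetilde Y^\delta_{\tau_n})(t-\tau_n)+\sum_{j=1}^m\sigma^{ij}(\tau_n,\widetilde Y^\delta_{\tau_n})(B^j_{t}-B^j_{\tau_n}),\quad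 t\in[\tau_n,\tau_{n+1}].$$ Let $t_u=\max\{\tau_n:\tau_n\le u\}$. (i) Assume (A), (B) and (C). Then for every $\varepsilon>0$ and $0<\rho<H$ there are $\delta_0>0$, an event $\Omega_{\varepsilon,\delta_0,\rho}$ with $P(\Omega_{\varepsilon,\delta_0,\rho})>1-\varepsilon$ and a finite random variable $C(\omega)$, not depending on $\delta$, such that for every $\omega\in\Omega_{\varepsilon,\delta_0,\rho}$ and every $\delta=T/N<\delta_0$ one has $|Y^\delta_t|\le C(\omega)$ for $t\in[0,T]$ and $|Y^\delta_{t_s}-Y^\delta_{t_r}|\le C(\omega)(t_s-t_r)^{H-\rho}$ for $0\le r<s\le T$. (ii) Assume (A) without item 2), (B), and that $b$ and $\sigma$ are bounded. Then for every $0<\rho<H$ there is a finite random variable $C(\omega)$, not depending on $\delta$, such that for almost every $\omega$ and every $\delta=T/N$, $N\ge1$, one has $|Y^\delta_t|\le C(\omega)$ for $t\in[0,T]$ and $|Y^\delta_s-Y^\delta_r|\le C(\omega)(s-r)^{H-\rho}$ for $0\le r<s\le T$. -/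

import Mathlib

open MeasureTheory ProbabilityTheory
open scoped NNReal

namespace EulerFBM

/-- `B` is a fractional Brownian motion with Hurst parameter `H`: a centered Gaussian process
with covariance `(t^{2H} + s^{2H} - |t-s|^{2H}) / 2`, with almost surely continuous paths. -/
structure IsFBM {Ω : Type*} [MeasurableSpace Ω] (P : Measure Ω) (H : ℝ)
    (B : ℝ≥0 → Ω → ℝ) : Prop where
  gaussian : IsGaussianProcess B P
  centered : ∀ t, ∫ ω, B t ω ∂P = 0
  covariance : ∀ t s : ℝ≥0, ∫ ω, B t ω * B s ω ∂P =
    1 / 2 * ((t : ℝ) ^ (2 * H) + (s : ℝ) ^ (2 * H) - |(t : ℝ) - (s : ℝ)| ^ (2 * H))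
  continuous_paths : ∀ᵐ ω ∂P, Continuous fun t => B t ω

/-- `|y| = ∑ i, |y i|` for a vector. -/
def vecAbs {d : ℕ} (y : Fin d → ℝ) : ℝ := ∑ i, |y i|

/-- `|A| = ∑ i, ∑ j, |A i j|` for a matrix. -/
def matAbs {d m : ℕ} (A : Matrix (Fin d) (Fin m) ℝ) : ℝ := ∑ i, ∑ j, |A i j|

/-- The matrix of partial derivatives of the entries of `f` in the direction `x_k`, at `x`. -/
noncomputable def partialDeriv {d m : ℕ} (f : (Fin d → ℝ) → Matrix (Fin d) (Fin m) ℝ)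
    (k : Fin d) (x : Fin d → ℝ) : Matrix (Fin d) (Fin m) ℝ :=
  Matrix.of fun i j => fderiv ℝ (fun y => f y i j) x (Pi.single k 1)

section Coefficients

variable {d m : ℕ} (T : ℝ)

/-- `σ(t, ·)` is differentiable for every `t ∈ [0,T]`. -/
def DiffInSpace (σ : ℝ → (Fin d → ℝ) → Matrix (Fin d) (Fin m) ℝ) : Prop :=
  ∀ t ∈ Set.Icc 0 T, ∀ i j, Differentiable ℝ fun x => σ t x i j

/-- Global Lipschitz continuity of `σ` in space, with constant `M`. -/
def LipInSpace (M : ℝ) (σ : ℝ → (Fin d → ℝ) → Matrix (Fin d) (Fin m) ℝ) : Prop :=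
  ∀ t ∈ Set.Icc 0 T, ∀ x y, matAbs (σ t x - σ t y) ≤ M * vecAbs (x - y)

/-- Local `κ`-Hölder continuity in space of the partial derivatives of `σ`. -/
def LocHolderDeriv (κ : ℝ) (σ : ℝ → (Fin d → ℝ) → Matrix (Fin d) (Fin m) ℝ) : Prop :=
  ∀ N : ℝ, 0 < N → ∃ MN : ℝ, 0 < MN ∧ ∀ t ∈ Set.Icc 0 T, ∀ k x y,
    vecAbs x ≤ N → vecAbs y ≤ N →
      matAbs (partialDeriv (σ t) k x - partialDeriv (σ t) k y) ≤ MN * vecAbs (x - y) ^ κ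

/-- `β`-Hölder continuity in time of `σ` and of its partial derivatives. -/
def HolderInTime (M β : ℝ) (σ : ℝ → (Fin d → ℝ) → Matrix (Fin d) (Fin m) ℝ) : Prop :=
  ∀ t ∈ Set.Icc 0 T, ∀ s ∈ Set.Icc 0 T, ∀ k x,
    matAbs (σ t x - σ s x) + matAbs (partialDeriv (σ t) k x - partialDeriv (σ s) k x)
      ≤ M * |t - s| ^ β

/-- Condition (A): differentiability and items 1), 2), 3). -/
def CondA (H : ℝ) (σ : ℝ → (Fin d → ℝ) → Matrix (Fin d) (Fin m) ℝ) : Prop :=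
  DiffInSpace T σ ∧ ∃ M β κ : ℝ, 0 < M ∧ 1 - H < β ∧ β ≤ 1 ∧ 1 / H - 1 < κ ∧ κ ≤ 1 ∧
    LipInSpace T M σ ∧ LocHolderDeriv T κ σ ∧ HolderInTime T M β σ

/-- Condition (A) without item 2). -/
def CondAWithout2 (H : ℝ) (σ : ℝ → (Fin d → ℝ) → Matrix (Fin d) (Fin m) ℝ) : Prop :=
  DiffInSpace T σ ∧ ∃ M β : ℝ, 0 < M ∧ 1 - H < β ∧ β ≤ 1 ∧
    LipInSpace T M σ ∧ HolderInTime T M β σ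

/-- Condition (B): the drift is locally Lipschitz in space and of linear growth. -/
def CondB (b : ℝ → (Fin d → ℝ) → Fin d → ℝ) : Prop :=
  (∀ N : ℝ, 0 < N → ∃ LN : ℝ, 0 < LN ∧ ∀ t ∈ Set.Icc 0 T, ∀ x y,
    vecAbs x ≤ N → vecAbs y ≤ N → vecAbs (b t x - b t y) ≤ LN * vecAbs (x - y)) ∧
  ∃ L : ℝ, ∀ t ∈ Set.Icc 0 T, ∀ x, vecAbs (b t x) ≤ L * (1 + vecAbs x)

/-- Condition (C): linear growth of `σ`. -/
def CondC (σ : ℝ → (Fin d → ℝ) → Matrix (Fin d) (Fin m) ℝ) : Prop :=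
  ∃ C : ℝ, ∀ t ∈ Set.Icc 0 T, ∀ x, matAbs (σ t x) ≤ C * (1 + vecAbs x)

/-- `b` and `σ` are bounded. -/
def BoundedCoeffs (b : ℝ → (Fin d → ℝ) → Fin d → ℝ)
    (σ : ℝ → (Fin d → ℝ) → Matrix (Fin d) (Fin m) ℝ) : Prop :=
  ∃ K : ℝ, ∀ t ∈ Set.Icc 0 T, ∀ x, vecAbs (b t x) ≤ K ∧ matAbs (σ t x) ≤ K

end Coefficients

section Scheme

variable (T : ℝ) (N : ℕ)

/-- The step `δ = T / N`. -/
noncomputable def step : ℝ := T / N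

/-- The grid point `τ_n = n δ`. -/
noncomputable def grid (n : ℕ) : ℝ := n * step T N

/-- `n_u = max {n : τ_n ≤ u}`. -/
noncomputable def gridIndex (u : ℝ) : ℕ := ⌊u / step T N⌋₊

/-- `t_u = τ_{n_u}`, the last grid point not after `u`. -/
noncomputable def lastGrid (u : ℝ) : ℝ := grid T N (gridIndex T N u)

theorem gridIndex_isGreatest (hT : 0 < T) (hN : 0 < N) (u : ℝ) (hu : 0 ≤ u) :
    IsGreatest {n : ℕ | grid T N n ≤ u} (gridIndex T N u) := by
  have hδ : 0 < step T N := div_pos hT (Nat.cast_pos.2 hN)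
  have h0 : 0 ≤ u / step T N := div_nonneg hu hδ.le
  refine ⟨?_, fun n hn => ?_⟩
  · exact (le_div_iff₀ hδ).1 (Nat.floor_le h0)
  · exact Nat.le_floor ((le_div_iff₀ hδ).2 hn)

variable {d m : ℕ} (b : ℝ → (Fin d → ℝ) → Fin d → ℝ)
  (σ : ℝ → (Fin d → ℝ) → Matrix (Fin d) (Fin m) ℝ)
  (x₀ : Fin d → ℝ) (w : Fin m → ℝ≥0 → ℝ)

/-- The discrete Euler approximation at `τ_n`, for coefficients `b`, `σ`, initial value `x₀`
and driving path `w`. -/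
noncomputable def eulerDiscrete : ℕ → Fin d → ℝ
  | 0 => x₀
  | n + 1 => fun i => eulerDiscrete n i + b (grid T N n) (eulerDiscrete n) i * step T N +
      ∑ j, σ (grid T N n) (eulerDiscrete n) i j *
        (w j (grid T N (n + 1)).toNNReal - w j (grid T N n).toNNReal)

/-- The continuous interpolation of the Euler approximation. -/
noncomputable def euler (t : ℝ) : Fin d → ℝ := fun i =>
  let n := gridIndex T N t
  let y := eulerDiscrete T N b σ x₀ w n
  y i + b (grid T N n) y i * (t - grid T N n) +
    ∑ j, σ (grid T N n) y i j * (w j t.toNNReal - w j (grid T N n).toNNReal)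

end Scheme

end EulerFBM

/-!
The almost sure statement is a pathwise one: if the driving path is `α`-Hölder for every `α < H`,
`σ` is Lipschitz in space and `β`-Hölder in time with `β > 1 - H`, and `b` and `σ` grow at most
linearly, then all Euler approximations share one bound and one Hölder constant. Both parts of the
theorem are instances, since linear growth is assumed in the first and follows from boundedness in
the second. The bounds hold on an event of full measure, for every step.

**Pathwise bound.** Choose `α < H` with `α > 1 / 2` and `α + β > 1`, and put `γ = min α β`. For grid
indices `p ≤ q` let `J p q` be the difference between `y q - y p` and its approximation
`∑ δ • b + σ(τ_p, y_p) (w_q - w_p)`. It vanishes on single steps, and its additivity defect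
`(σ(τ_r, y_r) - σ(τ_p, y_p)) (w_q - w_r)` is of order `(τ_q - τ_p) ^ (α + γ)`, so `J` is of that
order too (`norm_le_of_discrete_sewing`). Hence on a block of length at most `h` the best Hölder
constant `S` of `y` satisfies `S ≤ G h ^ γ (1 + S) + G (1 + |y_p|)`
(`IsEulerScheme.norm_sub_le_improve`). For `h` small this is a contraction that bounds `S` linearly
in `|y_p|`, and finitely many blocks cover `[0, T]`; where a block boundary falls inside a grid
cell, the single step across it is estimated directly (`exists_bound_of_isEulerScheme`). Interpolation
inside the cells is elementary (`exists_bound_euler`).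

**Driving paths.** Increments of fractional Brownian motion are Gaussian with variance
`|t - s| ^ (2 H)`, so their moments scale like `|t - s| ^ (H p)` for every `p`. Kolmogorov's dyadic
argument (`ae_exists_holder_of_moment`) turns this into Hölder paths of every order below `H`.

**Measurability of the constant.** The constants of the coefficient conditions depend on `ω` in an
uncontrolled way. The random constant is therefore taken as the supremum, over all steps and over a
countable dense set of times, of the measurable quantities to be bounded; continuity of the paths
extends the bound to all times (`exists_measurable_holder_bound`).
-/

namespace EulerFBM

/-! ### Discrete sewing -/

/-- Discrete sewing: a two-parameter family that vanishes on single steps and whose additivity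
defect is of order `(q - p) ^ θ` with `θ > 1` is itself of that order, with a constant depending
only on `θ`. -/
theorem norm_le_of_discrete_sewing {E : Type*} [SeminormedAddCommGroup E] {J : ℕ → ℕ → E}
    {D θ : ℝ} (hD : 0 ≤ D) (hθ : 1 < θ) {p₀ q₀ : ℕ}
    (h0 : ∀ k, J k k = 0) (h1 : ∀ k, p₀ ≤ k → k + 1 ≤ q₀ → J k (k + 1) = 0)
    (h : ∀ p r q, p₀ ≤ p → p ≤ r → r ≤ q → q ≤ q₀ →
      ‖J p q - J p r - J r q‖ ≤ D * ((q : ℝ) - p) ^ θ)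
    {p q : ℕ} (hp : p₀ ≤ p) (hpq : p ≤ q) (hq : q ≤ q₀) :
    ‖J p q‖ ≤ D / (1 - (2 / 3 : ℝ) ^ (θ - 1)) * ((q : ℝ) - p) ^ θ := by
  set κ : ℝ := (2 / 3 : ℝ) ^ (θ - 1) with hκ
  have hκ1 : κ < 1 := Real.rpow_lt_one (by norm_num) (by norm_num) (by linarith)
  set c := D / (1 - κ) with hc
  have hc0 : 0 ≤ c := div_nonneg hD (by linarith)
  have hcD : c * κ + D = c := by
    rw [hc]; field_simp [(by linarith : (1 - κ) ≠ 0)]; ring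
  have key : ∀ n : ℕ, ∀ p, p₀ ≤ p → p + n ≤ q₀ → ‖J p (p + n)‖ ≤ c * (n : ℝ) ^ θ := by
    intro n
    induction n using Nat.strong_induction_on with
    | _ n ih =>
      intro p hp hn
      rcases Nat.lt_or_ge n 2 with h2 | h2
      · have : J p (p + n) = 0 := by
          interval_cases n
          · exact h0 p
          · exact h1 p hp hn
        rw [this, norm_zero]; positivity
      · -- split at the midpoint; both halves have length at most `2 n / 3`
        set k := n / 2
        set l := n - k
        have hl : (l : ℝ) ≤ 2 / 3 * n := by
          have : 3 * l ≤ 2 * n := by omega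
          have : (3 : ℝ) * l ≤ 2 * n := by exact_mod_cast this
          linarith
        have hk : (k : ℝ) ≤ 2 / 3 * n := by
          have : 3 * k ≤ 2 * n := by omega
          have : (3 : ℝ) * k ≤ 2 * n := by exact_mod_cast this
          linarith
        have hkl : (k : ℝ) + l = n := by
          have : k + l = n := by omega
          exact_mod_cast this
        have e1 := ih k (by omega) p hp (by omega)
        have e2 := ih l (by omega) (p + k) (by omega) (by omega)
        have e3 := h p (p + k) (p + n) hp (by omega) (by omega) hn
        rw [show p + k + l = p + n by omega] at e2
        rw [show ((p + n : ℕ) : ℝ) - p = n by push_cast; ring] at e3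
        have hn0 : (0 : ℝ) < n := by exact_mod_cast (by omega : 0 < n)
        have aux : ∀ x : ℝ, 0 < x → x ≤ 2 / 3 * n → x ^ θ ≤ x * (κ * (n : ℝ) ^ (θ - 1)) := by
          intro x hx hxn
          calc x ^ θ = x ^ (1 + (θ - 1)) := by ring_nf
            _ = x * x ^ (θ - 1) := by rw [Real.rpow_add hx, Real.rpow_one]
            _ ≤ x * (2 / 3 * n) ^ (θ - 1) := by
              gcongr
            _ = _ := by rw [Real.mul_rpow (by norm_num) hn0.le]
        have a1 := aux k (by exact_mod_cast (by omega : 0 < k)) hk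
        have a2 := aux l (by exact_mod_cast (by omega : 0 < l)) hl
        have a3 : (n : ℝ) ^ θ = n * (n : ℝ) ^ (θ - 1) := by
          calc (n : ℝ) ^ θ = (n : ℝ) ^ (1 + (θ - 1)) := by ring_nf
            _ = _ := by rw [Real.rpow_add hn0, Real.rpow_one]
        calc ‖J p (p + n)‖
            = ‖(J p (p + n) - J p (p + k) - J (p + k) (p + n)) + J p (p + k)
                + J (p + k) (p + n)‖ := by congr 1; abel
          _ ≤ D * (n : ℝ) ^ θ + c * (k : ℝ) ^ θ + c * (l : ℝ) ^ θ :=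
              (norm_add₃_le).trans (by gcongr)
          _ ≤ D * (n : ℝ) ^ θ + c * (k * (κ * (n : ℝ) ^ (θ - 1)))
                + c * (l * (κ * (n : ℝ) ^ (θ - 1))) := by gcongr
          _ = D * (n : ℝ) ^ θ + c * κ * ((k + l) * (n : ℝ) ^ (θ - 1)) := by ring
          _ = (c * κ + D) * (n : ℝ) ^ θ := by rw [hkl, ← a3]; ring
          _ = c * (n : ℝ) ^ θ := by rw [hcD]
  obtain ⟨n, rfl⟩ := Nat.exists_eq_add_of_le hpq
  have := key n p hp hq
  rwa [show ((p + n : ℕ) : ℝ) - p = n by push_cast; ring]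

/-! ### Euler schemes driven by a Hölder sequence -/

/-- Sequences `y : ℕ → E` produced by `N` steps of length `δ` of an explicit scheme with drift
increments `δ • a n` and noise increments `∑ j, (w (n + 1) j - w n j) • A n j`, together with the
quantitative hypotheses on the data: `w` is `α`-Hölder with constant `K`, the coefficients `a n` and
`A n` grow at most linearly in `y n`, and the increments of `A` are controlled by a `β`-Hölder
modulus in time and by the increments of `y`. -/
structure IsEulerScheme {E ι : Type*} [NormedAddCommGroup E] [NormedSpace ℝ E] [Fintype ι]
    (α β K L M δ : ℝ) (N : ℕ) (y a : ℕ → E) (A : ℕ → ι → E) (w : ℕ → ι → ℝ) : Prop where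
  succ : ∀ n < N, y (n + 1) = y n + δ • a n + ∑ j, (w (n + 1) j - w n j) • A n j
  noise : ∀ p q, p ≤ q → q ≤ N → ∀ j, |w q j - w p j| ≤ K * (((q : ℝ) - p) * δ) ^ α
  drift : ∀ n ≤ N, ‖a n‖ ≤ L * (1 + ‖y n‖)
  growth : ∀ n ≤ N, ∑ j, ‖A n j‖ ≤ L * (1 + ‖y n‖)
  modulus : ∀ p q, p ≤ q → q ≤ N →
    ∑ j, ‖A q j - A p j‖ ≤ M * ((((q : ℝ) - p) * δ) ^ β + ‖y q - y p‖)

section Scheme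

variable {E ι : Type*} [NormedAddCommGroup E] [NormedSpace ℝ E] [Fintype ι]

theorem norm_sum_smul_le {c : ι → ℝ} {v : ι → E} {C : ℝ} (hc : ∀ j, |c j| ≤ C) :
    ‖∑ j, c j • v j‖ ≤ C * ∑ j, ‖v j‖ := by
  rw [Finset.mul_sum]
  refine (norm_sum_le _ _).trans (Finset.sum_le_sum fun j _ => ?_)
  rw [norm_smul, Real.norm_eq_abs]
  exact mul_le_mul_of_nonneg_right (hc j) (norm_nonneg _)

/-- The sewing constant at exponent `θ`. -/
noncomputable def sewingConst (θ : ℝ) : ℝ := 1 / (1 - (2 / 3 : ℝ) ^ (θ - 1))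

theorem sewingConst_nonneg {θ : ℝ} (hθ : 1 < θ) : 0 ≤ sewingConst θ :=
  one_div_nonneg.2 (sub_nonneg.2
    (Real.rpow_le_one (by norm_num) (by norm_num) (by linarith)))

/-- The constant of the local Hölder estimate for an Euler scheme: the sewing error, the drift and
the noise with frozen coefficients contribute one term each. -/
noncomputable def blockConst (θ K L M : ℝ) : ℝ := sewingConst θ * K * M + L + K * L

namespace IsEulerScheme

variable {α β γ K L M δ : ℝ} {N : ℕ} {y a : ℕ → E} {A : ℕ → ι → E} {w : ℕ → ι → ℝ}

/-- One improvement of the Hölder constant on a short block: if `S` is an admissible constant, so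
is the right-hand side. The increment of `y` is compared with its one-step approximation, and the
error is estimated by sewing. -/
theorem norm_sub_le_improve (hS : IsEulerScheme α β K L M δ N y a A w)
    (hK : 0 ≤ K) (hL : 0 ≤ L) (hM : 0 ≤ M) (hδ : 0 < δ) (hγ : 0 < γ) (hγα : γ ≤ α) (hγβ : γ ≤ β)
    (hα : α ≤ 1) (hθ : 1 < α + γ) {h : ℝ} (h1 : h ≤ 1) {p₀ q₀ : ℕ} (hq₀ : q₀ ≤ N)
    (hlen : ((q₀ : ℝ) - p₀) * δ ≤ h) {S : ℝ} (hS0 : 0 ≤ S)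
    (hSy : ∀ p q, p₀ ≤ p → p ≤ q → q ≤ q₀ → ‖y q - y p‖ ≤ S * (((q : ℝ) - p) * δ) ^ α)
    {p q : ℕ} (hp : p₀ ≤ p) (hpq : p < q) (hq : q ≤ q₀) :
    ‖y q - y p‖ ≤ (blockConst (α + γ) K L M * (h ^ γ * (1 + S) + (1 + ‖y p₀‖))) *
      (((q : ℝ) - p) * δ) ^ α := by
  have cast_le : ∀ {k l : ℕ}, k ≤ l → (k : ℝ) ≤ l := fun h => by exact_mod_cast h
  have hlen' : ∀ {k l : ℕ}, p₀ ≤ k → k ≤ l → l ≤ q₀ → ((l : ℝ) - k) * δ ≤ h := by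
    intro k l hk hkl hl
    refine le_trans ?_ hlen
    have := cast_le hk; have := cast_le hl
    gcongr
  have hlen0 : ∀ {k l : ℕ}, k ≤ l → 0 ≤ ((l : ℝ) - k) * δ := fun hkl =>
    mul_nonneg (sub_nonneg.2 (cast_le hkl)) hδ.le
  set x := ((q : ℝ) - p) * δ with hx
  have hx0 : 0 < x := mul_pos (sub_pos.2 (by exact_mod_cast hpq)) hδ
  have hxh : x ≤ h := hlen' hp hpq.le hq
  have hh0 : 0 < h := hx0.trans_le hxh
  have hα0 : 0 < α := hγ.trans_le hγα
  have hc := sewingConst_nonneg hθ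
  -- sizes on the block
  have hy : ∀ n, p₀ ≤ n → n ≤ q₀ → 1 + ‖y n‖ ≤ 1 + ‖y p₀‖ + h ^ γ * S := by
    intro n hn hnq
    have e1 := hSy p₀ n le_rfl hn hnq
    have e2 : (((n : ℝ) - p₀) * δ) ^ α ≤ h ^ γ :=
      (Real.rpow_le_rpow (hlen0 hn) (hlen' le_rfl hn hnq) hα0.le).trans
        (Real.rpow_le_rpow_of_exponent_ge hh0 h1 hγα)
    have e3 : ‖y n‖ ≤ ‖y p₀‖ + ‖y n - y p₀‖ := by
      simpa using norm_add_le (y p₀) (y n - y p₀)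
    nlinarith [mul_le_mul_of_nonneg_left e2 hS0]
  set Z := 1 + ‖y p₀‖ + h ^ γ * S with hZ
  have hZ0 : 0 ≤ Z := by positivity
  -- the error of the one-step approximation
  set J : ℕ → ℕ → E := fun p q => y q - y p - ∑ n ∈ Finset.Ico p q, δ • a n -
    ∑ j, (w q j - w p j) • A p j with hJ
  have hJ0 : ∀ k, J k k = 0 := fun k => by simp [hJ]
  have hJ1 : ∀ k, p₀ ≤ k → k + 1 ≤ q₀ → J k (k + 1) = 0 := by
    intro k _ hk
    simp only [hJ, hS.succ k (by omega), Nat.Ico_succ_singleton, Finset.sum_singleton]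
    abel
  have hJdef : ∀ p r q, p₀ ≤ p → p ≤ r → r ≤ q → q ≤ q₀ →
      ‖J p q - J p r - J r q‖ ≤ (K * M * (1 + S) * δ ^ (α + γ)) * ((q : ℝ) - p) ^ (α + γ) := by
    intro p r q hp hpr hrq hq
    have e : J p q - J p r - J r q = ∑ j, (w q j - w r j) • (A r j - A p j) := by
      have e1 : ∑ n ∈ Finset.Ico p q, δ • a n =
          ∑ n ∈ Finset.Ico p r, δ • a n + ∑ n ∈ Finset.Ico r q, δ • a n :=
        (Finset.sum_Ico_consecutive _ hpr hrq).symm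
      have e2 : ∑ j, (w q j - w p j) • A p j = ∑ j, (w q j - w r j) • A p j +
          ∑ j, (w r j - w p j) • A p j := by
        rw [← Finset.sum_add_distrib]
        refine Finset.sum_congr rfl fun j _ => ?_
        rw [← add_smul]; congr 1; ring
      simp only [hJ, smul_sub, Finset.sum_sub_distrib, e1, e2]
      abel
    rw [e]
    set u := ((q : ℝ) - p) * δ with hu
    have hu0 : 0 ≤ u := hlen0 (hpr.trans hrq)
    have hu1 : u ≤ 1 := (hlen' hp (hpr.trans hrq) hq).trans h1
    have hr0 : 0 ≤ ((r : ℝ) - p) * δ := hlen0 hpr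
    have hru : ((r : ℝ) - p) * δ ≤ u := by
      have := cast_le hrq
      simp only [hu]; gcongr
    have hqr : ((q : ℝ) - r) * δ ≤ u := by
      have := cast_le hpr
      simp only [hu]; gcongr
    have pow_u : ∀ {e : ℝ}, γ ≤ e → (((r : ℝ) - p) * δ) ^ e ≤ u ^ γ := fun {e} he =>
      (Real.rpow_le_rpow_of_exponent_ge' hr0 (hru.trans hu1) hγ.le he).trans
        (Real.rpow_le_rpow hr0 hru hγ.le)
    have f1 : ∀ j, |w q j - w r j| ≤ K * u ^ α := fun j =>
      (hS.noise r q hrq (hq.trans hq₀) j).trans (by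
        gcongr; exact hlen0 hrq)
    have f2 : ∑ j, ‖A r j - A p j‖ ≤ M * (u ^ γ + S * u ^ γ) := by
      refine (hS.modulus p r hpr (hrq.trans (hq.trans hq₀))).trans ?_
      gcongr
      · exact pow_u hγβ
      · exact (hSy p r hp hpr (hrq.trans hq)).trans
          (mul_le_mul_of_nonneg_left (pow_u hγα) hS0)
    calc ‖∑ j, (w q j - w r j) • (A r j - A p j)‖
        ≤ K * u ^ α * ∑ j, ‖A r j - A p j‖ := norm_sum_smul_le f1
      _ ≤ K * u ^ α * (M * (u ^ γ + S * u ^ γ)) := by gcongr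
      _ = K * M * (1 + S) * (u ^ α * u ^ γ) := by ring
      _ = K * M * (1 + S) * u ^ (α + γ) := by rw [Real.rpow_add_of_nonneg hu0 hα0.le hγ.le]
      _ = _ := by
        rw [hu, Real.mul_rpow (sub_nonneg.2 (cast_le (hpr.trans hrq))) hδ.le]; ring
  have hJle : ‖J p q‖ ≤ sewingConst (α + γ) * (K * M * (1 + S)) * (h ^ γ * x ^ α) := by
    refine (norm_le_of_discrete_sewing (by positivity) hθ hJ0 hJ1 hJdef hp hpq.le hq).trans ?_
    calc _ = sewingConst (α + γ) * (K * M * (1 + S)) * x ^ (α + γ) := by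
          rw [hx, Real.mul_rpow (sub_nonneg.2 (cast_le hpq.le)) hδ.le, sewingConst]; ring
      _ = sewingConst (α + γ) * (K * M * (1 + S)) * (x ^ γ * x ^ α) := by
          rw [Real.rpow_add hx0, mul_comm (x ^ α)]
      _ ≤ _ := by gcongr
  have hdrift : ‖∑ n ∈ Finset.Ico p q, δ • a n‖ ≤ L * Z * x ^ α := by
    have e1 : ‖∑ n ∈ Finset.Ico p q, δ • a n‖ ≤ ∑ n ∈ Finset.Ico p q, δ * (L * Z) := by
      refine (norm_sum_le _ _).trans (Finset.sum_le_sum fun n hn => ?_)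
      rw [Finset.mem_Ico] at hn
      rw [norm_smul, Real.norm_eq_abs, abs_of_pos hδ]
      gcongr
      exact (hS.drift n (by omega)).trans
        (mul_le_mul_of_nonneg_left (hy n (by omega) (by omega)) hL)
    refine e1.trans ?_
    rw [Finset.sum_const, Nat.card_Ico, nsmul_eq_mul, Nat.cast_sub hpq.le]
    have e2 : x ≤ x ^ α := by
      simpa using Real.rpow_le_rpow_of_exponent_ge hx0 (hxh.trans h1) hα
    calc ((q : ℝ) - p) * (δ * (L * Z)) = L * Z * x := by rw [hx]; ring
      _ ≤ L * Z * x ^ α := by gcongr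
  have hnoise : ‖∑ j, (w q j - w p j) • A p j‖ ≤ K * L * Z * x ^ α := by
    refine (norm_sum_smul_le (hS.noise p q hpq.le (hq.trans hq₀))).trans ?_
    calc K * x ^ α * ∑ j, ‖A p j‖ ≤ K * x ^ α * (L * Z) := by
          gcongr
          exact (hS.growth p (by omega)).trans
            (mul_le_mul_of_nonneg_left (hy p hp (by omega)) hL)
      _ = _ := by ring
  have hsplit : y q - y p = J p q + ∑ n ∈ Finset.Ico p q, δ • a n +
      ∑ j, (w q j - w p j) • A p j := by simp only [hJ]; abel
  have hxα : 0 ≤ x ^ α := by positivity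
  have hhγ : 0 ≤ h ^ γ := by positivity
  calc ‖y q - y p‖ ≤ sewingConst (α + γ) * (K * M * (1 + S)) * (h ^ γ * x ^ α) +
        L * Z * x ^ α + K * L * Z * x ^ α := by
        rw [hsplit]; exact (norm_add₃_le).trans (by gcongr)
    _ = (sewingConst (α + γ) * K * M * (h ^ γ * (1 + S)) + (L + K * L) * Z) * x ^ α := by ring
    _ ≤ (sewingConst (α + γ) * K * M * (h ^ γ * (1 + S) + (1 + ‖y p₀‖)) +
          (L + K * L) * (h ^ γ * (1 + S) + (1 + ‖y p₀‖))) * x ^ α := by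
        have : Z ≤ h ^ γ * (1 + S) + (1 + ‖y p₀‖) := by rw [hZ]; linarith
        have : h ^ γ * (1 + S) ≤ h ^ γ * (1 + S) + (1 + ‖y p₀‖) := by
          linarith [norm_nonneg (y p₀)]
        gcongr
    _ = _ := by rw [blockConst]; ring

/-- On blocks short enough for the improvement to be a contraction, the Hölder constant of an
Euler scheme is controlled by the value at the left end of the block. -/
theorem norm_sub_le_of_short (hS : IsEulerScheme α β K L M δ N y a A w)
    (hK : 0 ≤ K) (hL : 0 ≤ L) (hM : 0 ≤ M) (hδ : 0 < δ) (hγ : 0 < γ) (hγα : γ ≤ α) (hγβ : γ ≤ β)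
    (hα : α ≤ 1) (hθ : 1 < α + γ) {h : ℝ} (h1 : h ≤ 1)
    (hh : blockConst (α + γ) K L M * h ^ γ ≤ 1 / 2) {p q : ℕ} (hpq : p ≤ q) (hq : q ≤ N)
    (hlen : ((q : ℝ) - p) * δ ≤ h) :
    ‖y q - y p‖ ≤ ((1 + 2 * blockConst (α + γ) K L M) * (1 + ‖y p‖)) *
      (((q : ℝ) - p) * δ) ^ α := by
  have hG : 0 ≤ blockConst (α + γ) K L M := by
    have := sewingConst_nonneg hθ
    unfold blockConst; positivity
  set G := blockConst (α + γ) K L M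
  have hα0 : 0 < α := hγ.trans_le hγα
  rcases hpq.eq_or_lt with rfl | hlt
  · simp [Real.zero_rpow hα0.ne']
  set s := ((Finset.Icc p q) ×ˢ (Finset.Icc p q)).filter fun z => z.1 < z.2 with hs
  have mem : ∀ {k l}, (k, l) ∈ s ↔ p ≤ k ∧ k < l ∧ l ≤ q := by
    intro k l
    simp only [hs, Finset.mem_filter, Finset.mem_product, Finset.mem_Icc]; omega
  have hxpos : ∀ {k l : ℕ}, k < l → 0 < (((l : ℝ) - k) * δ) ^ α := fun hkl =>
    Real.rpow_pos_of_pos (mul_pos (sub_pos.2 (by exact_mod_cast hkl)) hδ) _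
  obtain ⟨⟨k, l⟩, hkl, hmax⟩ := s.exists_max_image
    (fun z => ‖y z.2 - y z.1‖ / (((z.2 : ℝ) - z.1) * δ) ^ α) ⟨(p, q), mem.2 ⟨le_rfl, hlt, le_rfl⟩⟩
  obtain ⟨hk, hkl, hl⟩ := mem.1 hkl
  set S := ‖y l - y k‖ / (((l : ℝ) - k) * δ) ^ α with hSdef
  have hS0 : 0 ≤ S := div_nonneg (norm_nonneg _) (hxpos hkl).le
  have hSy : ∀ k l, p ≤ k → k ≤ l → l ≤ q → ‖y l - y k‖ ≤ S * (((l : ℝ) - k) * δ) ^ α := by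
    intro k l hk hkl hl
    rcases hkl.eq_or_lt with rfl | hkl
    · simp [Real.zero_rpow hα0.ne']
    · exact (div_le_iff₀ (hxpos hkl)).1 (hmax (k, l) (mem.2 ⟨hk, hkl, hl⟩))
  have himp := hS.norm_sub_le_improve hK hL hM hδ hγ hγα hγβ hα hθ h1 hq hlen hS0 hSy hk hkl hl
  rw [← div_le_iff₀ (hxpos hkl), ← hSdef] at himp
  have hSle : S ≤ (1 + 2 * G) * (1 + ‖y p‖) := by
    have := mul_le_mul_of_nonneg_right hh (by linarith : 0 ≤ 1 + S)
    have := norm_nonneg (y p)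
    nlinarith
  exact (hSy p q le_rfl hpq le_rfl).trans (by gcongr; exact (hxpos hlt).le)

theorem norm_succ_le (hS : IsEulerScheme α β K L M δ N y a A w) (hK : 0 ≤ K)
    (hδ : 0 < δ) (hα : 0 ≤ α) {T : ℝ} (hT : N * δ ≤ T) {n : ℕ} (hn : n < N) :
    1 + ‖y (n + 1)‖ ≤ (1 + T * L + K * T ^ α * L) * (1 + ‖y n‖) := by
  have hδT : δ ≤ T := by
    have : (1 : ℝ) ≤ N := by exact_mod_cast (by omega : 1 ≤ N)
    nlinarith
  have e1 : ‖δ • a n‖ ≤ T * (L * (1 + ‖y n‖)) := by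
    rw [norm_smul, Real.norm_eq_abs, abs_of_pos hδ]
    exact mul_le_mul hδT (hS.drift n hn.le) (norm_nonneg _) (hδ.le.trans hδT)
  have e2 : ‖∑ j, (w (n + 1) j - w n j) • A n j‖ ≤ K * T ^ α * (L * (1 + ‖y n‖)) := by
    refine (norm_sum_smul_le (C := K * T ^ α) fun j => ?_).trans ?_
    · refine (hS.noise n (n + 1) (by omega) hn j).trans ?_
      rw [show (((n + 1 : ℕ) : ℝ) - n) * δ = δ by push_cast; ring]
      gcongr
    · have := hδ.le.trans hδT
      gcongr
      exact hS.growth n hn.le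
  rw [hS.succ n hn]
  have := norm_add₃_le (a := y n) (b := δ • a n) (c := ∑ j, (w (n + 1) j - w n j) • A n j)
  nlinarith

end IsEulerScheme

/-- Euler schemes on a bounded time interval are bounded and `α`-Hölder on the grid, with a
constant that does not depend on the step. -/
theorem exists_bound_of_isEulerScheme (E ι : Type*) [NormedAddCommGroup E] [NormedSpace ℝ E]
    [Fintype ι] {α β K L M T : ℝ} (hK : 0 ≤ K) (hL : 0 ≤ L)
    (hM : 0 ≤ M) (hT : 0 ≤ T) (hα : α ≤ 1) (hα2 : 1 / 2 < α) (hαβ : 1 < α + β) (y₀ : E) :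
    ∃ C : ℝ, 0 ≤ C ∧ ∀ (δ : ℝ) (N : ℕ) (y a : ℕ → E) (A : ℕ → ι → E) (w : ℕ → ι → ℝ), 0 < δ →
      N * δ ≤ T → y 0 = y₀ → IsEulerScheme α β K L M δ N y a A w →
      (∀ n ≤ N, ‖y n‖ ≤ C) ∧
      ∀ p q, p ≤ q → q ≤ N → ‖y q - y p‖ ≤ C * (((q : ℝ) - p) * δ) ^ α := by
  set γ := min α β with hγdef
  have hγα : γ ≤ α := min_le_left _ _
  have hγβ : γ ≤ β := min_le_right _ _
  have hγ : 0 < γ := lt_min (by linarith) (by linarith)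
  have hθ : 1 < α + γ := by
    rcases min_choice α β with h | h <;> rw [hγdef, h] <;> linarith
  have hG : 0 ≤ blockConst (α + γ) K L M := by
    have := sewingConst_nonneg hθ
    unfold blockConst; positivity
  set G := blockConst (α + γ) K L M with hGdef
  -- the block length that makes the improvement a contraction
  set h : ℝ := (1 / (2 * (G + 1))) ^ (1 / γ) with hh
  have hh0 : 0 < h := by positivity
  have hh1 : h ≤ 1 := Real.rpow_le_one (by positivity)
    (by rw [div_le_one (by positivity)]; linarith) (by positivity)
  have hhG : G * h ^ γ ≤ 1 / 2 := by
    rw [hh, ← Real.rpow_mul (by positivity), one_div_mul_cancel hγ.ne', Real.rpow_one, mul_one_div,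
      div_le_iff₀ (by positivity)]
    linarith
  set Q := (1 + T * L + K * T ^ α * L) * (1 + (1 + 2 * G)) with hQ
  have hTα : 0 ≤ T ^ α := Real.rpow_nonneg hT _
  have hQ1 : 1 ≤ Q := by
    have : 0 ≤ T * L + K * T ^ α * L := by positivity
    nlinarith
  set R := Q ^ ⌈T / h⌉₊ * (1 + ‖y₀‖) with hR
  have hR0 : 0 ≤ R := by positivity
  refine ⟨R + (1 + 2 * G) * (1 + R) + 2 * R / h ^ α, by positivity, ?_⟩
  intro δ N y a A w hδ hN hy0 hS
  have growth : ∀ p q, p ≤ q → q ≤ N → ((q : ℝ) - p) * δ ≤ h →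
      1 + ‖y q‖ ≤ (1 + (1 + 2 * G)) * (1 + ‖y p‖) := by
    intro p q hpq hq hlen
    have e1 := hS.norm_sub_le_of_short hK hL hM hδ hγ hγα hγβ hα hθ hh1 hhG hpq hq hlen
    have hx0 : 0 ≤ ((q : ℝ) - p) * δ :=
      mul_nonneg (sub_nonneg.2 (by exact_mod_cast hpq)) hδ.le
    have e2 : (((q : ℝ) - p) * δ) ^ α ≤ 1 :=
      Real.rpow_le_one hx0 (hlen.trans hh1) (by linarith)
    have e3 : ‖y q‖ ≤ ‖y p‖ + ‖y q - y p‖ := by simpa using norm_add_le (y p) (y q - y p)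
    have e4 : 0 ≤ (1 + 2 * G) * (1 + ‖y p‖) := by positivity
    rw [← hGdef] at e1
    nlinarith
  have blocks : ∀ (j n : ℕ), n ≤ N → n * δ ≤ j * h → 1 + ‖y n‖ ≤ Q ^ j * (1 + ‖y₀‖) := by
    intro j
    induction j with
    | zero =>
      intro n _ hn
      have : n = 0 := by
        by_contra hne
        have : (0 : ℝ) < n := by exact_mod_cast Nat.pos_of_ne_zero hne
        have := mul_pos this hδ
        simp at hn; linarith
      simp [this, hy0]
    | succ j ih =>
      intro n hn hnj
      by_cases hcase : n * δ ≤ j * h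
      · refine (ih n hn hcase).trans ?_
        exact mul_le_mul_of_nonneg_right (pow_le_pow_right₀ hQ1 j.le_succ) (by positivity)
      -- `k` is the last grid index before time `j h`; one step leads past `j h`, and the rest of
      -- the way to `n` is a short block
      set k := ⌊j * h / δ⌋₊ with hk
      have hk1 : k * δ ≤ j * h := (le_div_iff₀ hδ).1 (Nat.floor_le (by positivity))
      have hk2 : j * h < (k + 1 : ℝ) * δ := (div_lt_iff₀ hδ).1 (Nat.lt_floor_add_one _)
      have hkn : k < n := by
        by_contra hnk
        have : (n : ℝ) ≤ k := by exact_mod_cast not_lt.1 hnk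
        nlinarith
      have f1 := ih k (by omega) hk1
      have f2 := hS.norm_succ_le hK hδ (by linarith) hN (show k < N by omega)
      have f3 := growth (k + 1) n hkn hn (by push_cast at hnj ⊢; linarith)
      calc 1 + ‖y n‖ ≤ (1 + (1 + 2 * G)) * (1 + ‖y (k + 1)‖) := f3
        _ ≤ (1 + (1 + 2 * G)) * ((1 + T * L + K * T ^ α * L) * (1 + ‖y k‖)) := by gcongr
        _ = Q * (1 + ‖y k‖) := by rw [hQ]; ring
        _ ≤ Q * (Q ^ j * (1 + ‖y₀‖)) := by gcongr
        _ = Q ^ (j + 1) * (1 + ‖y₀‖) := by ring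
  have bound : ∀ n ≤ N, ‖y n‖ ≤ R := by
    intro n hn
    have hnT : n * δ ≤ ⌈T / h⌉₊ * h := by
      have e1 : (n : ℝ) ≤ N := by exact_mod_cast hn
      have e2 : T ≤ ⌈T / h⌉₊ * h := (div_le_iff₀ hh0).1 (Nat.le_ceil _)
      nlinarith
    linarith [blocks _ n hn hnT]
  have hhα : 0 < h ^ α := by positivity
  have p1 : 0 ≤ (1 + 2 * G) * (1 + R) := by positivity
  have p2 : 0 ≤ 2 * R / h ^ α := by positivity
  refine ⟨fun n hn => (bound n hn).trans (by linarith), fun p q hpq hq => ?_⟩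
  have hx0 : 0 ≤ ((q : ℝ) - p) * δ :=
    mul_nonneg (sub_nonneg.2 (by exact_mod_cast hpq)) hδ.le
  have hxα : 0 ≤ (((q : ℝ) - p) * δ) ^ α := by positivity
  by_cases hlen : ((q : ℝ) - p) * δ ≤ h
  · refine (hS.norm_sub_le_of_short hK hL hM hδ hγ hγα hγβ hα hθ hh1 hhG hpq hq hlen).trans ?_
    gcongr
    have : (1 + 2 * G) * (1 + ‖y p‖) ≤ (1 + 2 * G) * (1 + R) := by
      gcongr; exact bound p (hpq.trans hq)
    linarith
  · have e1 : ‖y q - y p‖ ≤ 2 * R := by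
      linarith [norm_sub_le (y q) (y p), bound q hq, bound p (hpq.trans hq)]
    have e2 : h ^ α ≤ (((q : ℝ) - p) * δ) ^ α := by
      exact Real.rpow_le_rpow hh0.le (not_le.1 hlen).le (by linarith)
    calc ‖y q - y p‖ ≤ 2 * R / h ^ α * h ^ α := by rwa [div_mul_cancel₀ _ hhα.ne']
      _ ≤ 2 * R / h ^ α * (((q : ℝ) - p) * δ) ^ α := by gcongr
      _ ≤ _ := by gcongr; linarith

end Scheme

/-! ### Comparison of norms -/

section Norms

variable {d m : ℕ}

theorem vecAbs_nonneg (y : Fin d → ℝ) : 0 ≤ vecAbs y := Finset.sum_nonneg fun _ _ => abs_nonneg _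

theorem norm_le_vecAbs (y : Fin d → ℝ) : ‖y‖ ≤ vecAbs y :=
  (pi_norm_le_iff_of_nonneg (Finset.sum_nonneg fun _ _ => abs_nonneg _)).2 fun i =>
    Finset.single_le_sum (f := fun i => |y i|) (fun _ _ => abs_nonneg _) (Finset.mem_univ i)

theorem vecAbs_le_mul_norm (y : Fin d → ℝ) : vecAbs y ≤ d * ‖y‖ := by
  refine (Finset.sum_le_sum fun i _ => norm_le_pi_norm y i).trans ?_
  simp

theorem sum_norm_col_le_matAbs (A : Matrix (Fin d) (Fin m) ℝ) :
    ∑ j, ‖fun i => A i j‖ ≤ matAbs A := by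
  rw [matAbs, Finset.sum_comm]
  exact Finset.sum_le_sum fun j _ => norm_le_vecAbs _

theorem matAbs_nonneg (A : Matrix (Fin d) (Fin m) ℝ) : 0 ≤ matAbs A :=
  Finset.sum_nonneg fun _ _ => Finset.sum_nonneg fun _ _ => abs_nonneg _

theorem matAbs_add_le (A B : Matrix (Fin d) (Fin m) ℝ) : matAbs (A + B) ≤ matAbs A + matAbs B := by
  simp only [matAbs, ← Finset.sum_add_distrib]
  exact Finset.sum_le_sum fun i _ => Finset.sum_le_sum fun j _ => abs_add_le _ _

end Norms

/-! ### The time grid -/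

section Grid

variable {T : ℝ} {N : ℕ}

theorem step_pos (hT : 0 < T) (hN : 0 < N) : 0 < step T N := div_pos hT (Nat.cast_pos.2 hN)

theorem natCast_mul_step (hN : 0 < N) : N * step T N = T :=
  mul_div_cancel₀ _ (Nat.cast_ne_zero.2 hN.ne')

theorem grid_mem_Icc (hT : 0 < T) (hN : 0 < N) {n : ℕ} (hn : n ≤ N) :
    grid T N n ∈ Set.Icc 0 T := by
  have hδ := step_pos hT hN
  refine ⟨mul_nonneg n.cast_nonneg hδ.le, ?_⟩
  calc (n : ℝ) * step T N ≤ N * step T N := by gcongr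
    _ = T := natCast_mul_step hN

theorem gridIndex_le (hT : 0 < T) (hN : 0 < N) {t : ℝ} (ht : t ≤ T) : gridIndex T N t ≤ N := by
  have hδ := step_pos hT hN
  refine Nat.floor_le_of_le ((div_le_iff₀ hδ).2 ?_)
  rwa [natCast_mul_step hN]

theorem grid_gridIndex_le (hT : 0 < T) (hN : 0 < N) {t : ℝ} (ht : 0 ≤ t) :
    grid T N (gridIndex T N t) ≤ t :=
  (le_div_iff₀ (step_pos hT hN)).1 (Nat.floor_le (div_nonneg ht (step_pos hT hN).le))

theorem lt_grid_gridIndex_succ (hT : 0 < T) (hN : 0 < N) (t : ℝ) :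
    t < grid T N (gridIndex T N t + 1) := by
  have := (div_lt_iff₀ (step_pos hT hN)).1 (Nat.lt_floor_add_one (t / step T N))
  simpa [grid, gridIndex] using this

theorem gridIndex_mono (hT : 0 < T) (hN : 0 < N) {r s : ℝ} (h : r ≤ s) :
    gridIndex T N r ≤ gridIndex T N s :=
  Nat.floor_le_floor (div_le_div_of_nonneg_right h (step_pos hT hN).le)

theorem lastGrid_mem_Icc (hT : 0 < T) (hN : 0 < N) {t : ℝ} (ht : t ≤ T) :
    lastGrid T N t ∈ Set.Icc 0 T :=
  grid_mem_Icc hT hN (gridIndex_le hT hN ht)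

theorem lastGrid_mono (hT : 0 < T) (hN : 0 < N) {r s : ℝ} (h : r ≤ s) :
    lastGrid T N r ≤ lastGrid T N s :=
  mul_le_mul_of_nonneg_right (by exact_mod_cast gridIndex_mono hT hN h) (step_pos hT hN).le

end Grid

/-! ### The interpolated Euler approximation -/

section Pathwise

variable {d m : ℕ} (T : ℝ) (N : ℕ) (b : ℝ → (Fin d → ℝ) → Fin d → ℝ)
  (σ : ℝ → (Fin d → ℝ) → Matrix (Fin d) (Fin m) ℝ) (x₀ : Fin d → ℝ) (w : Fin m → ℝ≥0 → ℝ)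

/-- The Euler path on the `n`-th cell of the grid, extended to all times by the same formula. -/
noncomputable def eulerCell (n : ℕ) (t : ℝ) : Fin d → ℝ :=
  eulerDiscrete T N b σ x₀ w n +
    (t - grid T N n) • b (grid T N n) (eulerDiscrete T N b σ x₀ w n) +
    ∑ j, (w j t.toNNReal - w j (grid T N n).toNNReal) •
      fun i => σ (grid T N n) (eulerDiscrete T N b σ x₀ w n) i j

theorem euler_eq_eulerCell (t : ℝ) :
    euler T N b σ x₀ w t = eulerCell T N b σ x₀ w (gridIndex T N t) t := by
  ext i
  simp only [euler, eulerCell, Pi.add_apply, Pi.smul_apply, smul_eq_mul, Finset.sum_apply,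
    mul_comm]

theorem eulerCell_grid (n : ℕ) :
    eulerCell T N b σ x₀ w n (grid T N n) = eulerDiscrete T N b σ x₀ w n := by
  simp [eulerCell]

theorem eulerDiscrete_succ (n : ℕ) :
    eulerDiscrete T N b σ x₀ w (n + 1) = eulerCell T N b σ x₀ w n (grid T N (n + 1)) := by
  ext i
  have : grid T N (n + 1) - grid T N n = step T N := by simp only [grid]; push_cast; ring
  simp only [eulerDiscrete, eulerCell, this, Pi.add_apply, Pi.smul_apply, smul_eq_mul,
    Finset.sum_apply, mul_comm]

variable {T N b σ x₀ w}

theorem isEulerScheme_eulerDiscrete (hT : 0 < T) (hN : 0 < N) {M L α β K : ℝ} (hM : 0 ≤ M)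
    (hL : 0 ≤ L) (hLip : LipInSpace T M σ)
    (hTime : ∀ t ∈ Set.Icc 0 T, ∀ s ∈ Set.Icc 0 T, ∀ x, matAbs (σ t x - σ s x) ≤ M * |t - s| ^ β)
    (hb : ∀ t ∈ Set.Icc 0 T, ∀ x, vecAbs (b t x) ≤ L * (1 + vecAbs x))
    (hσ : ∀ t ∈ Set.Icc 0 T, ∀ x, matAbs (σ t x) ≤ L * (1 + vecAbs x))
    (hw : ∀ j, ∀ s ∈ Set.Icc 0 T, ∀ t ∈ Set.Icc 0 T,
      |w j t.toNNReal - w j s.toNNReal| ≤ K * |t - s| ^ α) :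
    IsEulerScheme α β K (L * (d + 1)) (M * (d + 1)) (step T N) N (eulerDiscrete T N b σ x₀ w)
      (fun n => b (grid T N n) (eulerDiscrete T N b σ x₀ w n))
      (fun n j i => σ (grid T N n) (eulerDiscrete T N b σ x₀ w n) i j)
      (fun n j => w j (grid T N n).toNNReal) := by
  set y := eulerDiscrete T N b σ x₀ w with hy
  have mem : ∀ {n}, n ≤ N → grid T N n ∈ Set.Icc 0 T := fun hn => grid_mem_Icc hT hN hn
  have hd : (0 : ℝ) ≤ d := d.cast_nonneg
  have hdist : ∀ {p q : ℕ}, p ≤ q →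
      |grid T N q - grid T N p| = ((q : ℝ) - p) * step T N := by
    intro p q hpq
    have h0 : (0 : ℝ) ≤ (q : ℝ) - p := sub_nonneg.2 (by exact_mod_cast hpq)
    rw [grid, grid, ← sub_mul, abs_of_nonneg (mul_nonneg h0 (step_pos hT hN).le)]
  have lin : ∀ z : Fin d → ℝ, L * (1 + vecAbs z) ≤ L * (d + 1) * (1 + ‖z‖) := by
    intro z
    rw [mul_assoc]
    have := vecAbs_le_mul_norm z
    gcongr
    nlinarith [norm_nonneg z]
  refine ⟨fun n _ => ?_, fun p q hpq hq j => ?_, fun n hn => ?_, fun n hn => ?_,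
    fun p q hpq hq => ?_⟩
  · have : grid T N (n + 1) - grid T N n = step T N := by simp only [grid]; push_cast; ring
    rw [hy, eulerDiscrete_succ, eulerCell, this]
  · rw [← hdist hpq]
    exact hw j _ (mem (hpq.trans hq)) _ (mem hq)
  · exact (norm_le_vecAbs _).trans ((hb _ (mem hn) _).trans (lin _))
  · exact (sum_norm_col_le_matAbs _).trans ((hσ _ (mem hn) _).trans (lin _))
  · have e1 := sum_norm_col_le_matAbs (σ (grid T N q) (y q) - σ (grid T N p) (y p))
    have e2 := matAbs_add_le (σ (grid T N q) (y q) - σ (grid T N q) (y p))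
      (σ (grid T N q) (y p) - σ (grid T N p) (y p))
    rw [sub_add_sub_cancel] at e2
    have e3 := hLip _ (mem hq) (y q) (y p)
    have e4 := hTime _ (mem hq) _ (mem (hpq.trans hq)) (y p)
    rw [hdist hpq] at e4
    have e5 := mul_le_mul_of_nonneg_left (vecAbs_le_mul_norm (y q - y p)) hM
    have e6 : 0 ≤ M * d * (((q : ℝ) - p) * step T N) ^ β := by
      have : 0 ≤ ((q : ℝ) - p) * step T N := hdist hpq ▸ abs_nonneg _
      positivity
    have e7 : 0 ≤ M * ‖y q - y p‖ := by positivity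
    refine e1.trans (e2.trans ?_)
    calc _ ≤ M * (d * ‖y q - y p‖) + M * (((q : ℝ) - p) * step T N) ^ β := by
          gcongr
          exact e3.trans e5
      _ ≤ _ := by linarith

/-- On one cell the Euler path is a linear function of time and of the driving path with frozen
coefficients, so it is as regular as the driving path. -/
theorem norm_eulerCell_sub_le (hT : 0 < T) {L α K R : ℝ} (hα : α ≤ 1) (hK : 0 ≤ K) {n : ℕ}
    (hR : L * (1 + ‖eulerDiscrete T N b σ x₀ w n‖) ≤ R)
    (ha : ‖b (grid T N n) (eulerDiscrete T N b σ x₀ w n)‖ ≤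
      L * (1 + ‖eulerDiscrete T N b σ x₀ w n‖))
    (hA : ∑ j, ‖fun i => σ (grid T N n) (eulerDiscrete T N b σ x₀ w n) i j‖ ≤
      L * (1 + ‖eulerDiscrete T N b σ x₀ w n‖))
    (hw : ∀ j, ∀ s ∈ Set.Icc 0 T, ∀ t ∈ Set.Icc 0 T,
      |w j t.toNNReal - w j s.toNNReal| ≤ K * |t - s| ^ α)
    {r s : ℝ} (hr : 0 ≤ r) (hrs : r ≤ s) (hs : s ≤ T) :
    ‖eulerCell T N b σ x₀ w n s - eulerCell T N b σ x₀ w n r‖ ≤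
      (T ^ (1 - α) + K) * R * (s - r) ^ α := by
  set y := eulerDiscrete T N b σ x₀ w n
  rcases hrs.eq_or_lt with rfl | hlt
  · have : 0 ≤ R := (norm_nonneg _).trans (ha.trans hR)
    rw [sub_self, sub_self, norm_zero]
    positivity
  have e : eulerCell T N b σ x₀ w n s - eulerCell T N b σ x₀ w n r =
      (s - r) • b (grid T N n) y +
        ∑ j, (w j s.toNNReal - w j r.toNNReal) • fun i => σ (grid T N n) y i j := by
    have e2 : ∑ j, (w j s.toNNReal - w j (grid T N n).toNNReal) •
          (fun i => σ (grid T N n) y i j) =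
        ∑ j, (w j s.toNNReal - w j r.toNNReal) • (fun i => σ (grid T N n) y i j) +
        ∑ j, (w j r.toNNReal - w j (grid T N n).toNNReal) •
          fun i => σ (grid T N n) y i j := by
      rw [← Finset.sum_add_distrib]
      refine Finset.sum_congr rfl fun j _ => ?_
      rw [← add_smul]; congr 1; ring
    rw [eulerCell, eulerCell, e2]
    module
  have hx : 0 < s - r := sub_pos.2 hlt
  have f1 : s - r ≤ T ^ (1 - α) * (s - r) ^ α := by
    calc s - r = (s - r) ^ (1 - α) * (s - r) ^ α := by
          rw [← Real.rpow_add hx]; simp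
      _ ≤ _ := by
          gcongr
          · linarith
  have f2 : ∀ j, |w j s.toNNReal - w j r.toNNReal| ≤ K * (s - r) ^ α := fun j => by
    simpa [abs_of_pos hx] using hw j r ⟨hr, hrs.trans hs⟩ s ⟨hr.trans hrs, hs⟩
  rw [e]
  calc _ ≤ ‖(s - r) • b (grid T N n) y‖ +
        ‖∑ j, (w j s.toNNReal - w j r.toNNReal) • fun i => σ (grid T N n) y i j‖ :=
        norm_add_le _ _
    _ ≤ (T ^ (1 - α) * (s - r) ^ α) * R + K * (s - r) ^ α * R := by
        gcongr
        · rw [norm_smul, Real.norm_eq_abs, abs_of_pos hx]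
          exact mul_le_mul f1 (ha.trans hR) (norm_nonneg _) (by positivity)
        · exact (norm_sum_smul_le f2).trans
            (mul_le_mul_of_nonneg_left (hA.trans hR) (by positivity))
    _ = _ := by ring

/-- The interpolated Euler approximations driven by an `α`-Hölder path are bounded and `α`-Hölder
on `[0, T]`, uniformly in the step. -/
theorem exists_bound_euler (hT : 0 < T) {M L α β K : ℝ} (hM : 0 ≤ M)
    (hL : 0 ≤ L) (hK : 0 ≤ K) (hα : α ≤ 1) (hα2 : 1 / 2 < α) (hαβ : 1 < α + β)
    (hLip : LipInSpace T M σ)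
    (hTime : ∀ t ∈ Set.Icc 0 T, ∀ s ∈ Set.Icc 0 T, ∀ x, matAbs (σ t x - σ s x) ≤ M * |t - s| ^ β)
    (hb : ∀ t ∈ Set.Icc 0 T, ∀ x, vecAbs (b t x) ≤ L * (1 + vecAbs x))
    (hσ : ∀ t ∈ Set.Icc 0 T, ∀ x, matAbs (σ t x) ≤ L * (1 + vecAbs x))
    (hw : ∀ j, ∀ s ∈ Set.Icc 0 T, ∀ t ∈ Set.Icc 0 T,
      |w j t.toNNReal - w j s.toNNReal| ≤ K * |t - s| ^ α) :
    ∃ C : ℝ, 0 ≤ C ∧ ∀ N : ℕ, 0 < N →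
      (∀ t ∈ Set.Icc 0 T, ‖euler T N b σ x₀ w t‖ ≤ C) ∧
      ∀ r s, 0 ≤ r → r ≤ s → s ≤ T →
        ‖euler T N b σ x₀ w s - euler T N b σ x₀ w r‖ ≤ C * (s - r) ^ α := by
  obtain ⟨C, hC, hbound⟩ := exists_bound_of_isEulerScheme (Fin d → ℝ) (Fin m) hK
    (by positivity : 0 ≤ L * (d + 1)) (by positivity : 0 ≤ M * (d + 1)) hT.le hα hα2 hαβ x₀
  have hα0 : 0 ≤ α := by linarith
  set R := L * (d + 1) * (1 + C) with hR
  have hR0 : 0 ≤ R := by positivity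
  set C₁ := (T ^ (1 - α) + K) * R with hC₁
  have hC₁0 : 0 ≤ C₁ := by positivity
  have hTα : 0 ≤ T ^ α := by positivity
  refine ⟨C + C₁ * T ^ α + (C + 2 * C₁), by positivity, fun N hN => ?_⟩
  have hS := isEulerScheme_eulerDiscrete (x₀ := x₀) hT hN hM hL hLip hTime hb hσ hw
  have hδ := step_pos hT hN
  obtain ⟨hy, hyH⟩ := hbound _ _ _ _ _ _ hδ (natCast_mul_step hN).le rfl hS
  have hcell : ∀ n ≤ N, ∀ r s, 0 ≤ r → r ≤ s → s ≤ T →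
      ‖eulerCell T N b σ x₀ w n s - eulerCell T N b σ x₀ w n r‖ ≤ C₁ * (s - r) ^ α := by
    intro n hn r s hr hrs hs
    exact norm_eulerCell_sub_le hT hα hK
      (mul_le_mul_of_nonneg_left (by linarith [hy n hn]) (by positivity))
      (hS.drift n hn) (hS.growth n hn) hw hr hrs hs
  constructor
  · rintro t ⟨ht0, htT⟩
    have hn := gridIndex_le hT hN htT
    have h1 := hcell _ hn _ t (grid_mem_Icc hT hN hn).1 (grid_gridIndex_le hT hN ht0) htT
    rw [eulerCell_grid, ← euler_eq_eulerCell] at h1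
    have h2 : (t - grid T N (gridIndex T N t)) ^ α ≤ T ^ α := by
      have := grid_gridIndex_le hT hN ht0
      have := (grid_mem_Icc hT hN hn).1
      exact Real.rpow_le_rpow (by linarith) (by linarith) hα0
    have h3 : ‖euler T N b σ x₀ w t‖ ≤ ‖eulerDiscrete T N b σ x₀ w (gridIndex T N t)‖ +
        ‖euler T N b σ x₀ w t - eulerDiscrete T N b σ x₀ w (gridIndex T N t)‖ := by
      simpa using norm_add_le (eulerDiscrete T N b σ x₀ w (gridIndex T N t))
        (euler T N b σ x₀ w t - eulerDiscrete T N b σ x₀ w (gridIndex T N t))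
    have h4 := mul_le_mul_of_nonneg_left h2 hC₁0
    linarith [hy _ hn]
  · intro r s hr hrs hs
    have hx : 0 ≤ (s - r) ^ α := Real.rpow_nonneg (sub_nonneg.2 hrs) _
    have hC₁T : 0 ≤ C₁ * T ^ α := by positivity
    set k := gridIndex T N r with hk
    set n := gridIndex T N s with hn
    have hnN : n ≤ N := gridIndex_le hT hN hs
    rcases (gridIndex_mono hT hN hrs).eq_or_lt with heq | hlt
    · rw [euler_eq_eulerCell, euler_eq_eulerCell, ← heq]
      exact (hcell _ (gridIndex_le hT hN (hrs.trans hs)) r s hr hrs hs).trans (by gcongr; linarith)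
    -- different cells: pass through the first grid point after `r` and the last one before `s`
    have g1 : r ≤ grid T N (k + 1) := (lt_grid_gridIndex_succ hT hN r).le
    have g2 : grid T N n ≤ s := grid_gridIndex_le hT hN (hr.trans hrs)
    have g3 : grid T N (k + 1) ≤ grid T N n :=
      mul_le_mul_of_nonneg_right (by exact_mod_cast hlt) hδ.le
    have h1 := hcell k (hlt.le.trans hnN) r (grid T N (k + 1)) hr g1 (g3.trans (g2.trans hs))
    have h2 := hcell n hnN (grid T N n) s (grid_mem_Icc hT hN hnN).1 g2 hs
    have h3 := hyH (k + 1) n hlt hnN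
    rw [← eulerDiscrete_succ, ← euler_eq_eulerCell] at h1
    rw [eulerCell_grid, ← euler_eq_eulerCell] at h2
    rw [show (((n : ℕ) : ℝ) - (k + 1 : ℕ)) * step T N = grid T N n - grid T N (k + 1) by
      simp only [grid]; ring] at h3
    have pw : ∀ {u v : ℝ}, r ≤ u → u ≤ v → v ≤ s → (v - u) ^ α ≤ (s - r) ^ α :=
      fun hu huv hv => Real.rpow_le_rpow (by linarith) (by linarith) hα0
    have p1 := mul_le_mul_of_nonneg_left (pw le_rfl g1 (g3.trans g2)) hC₁0
    have p2 := mul_le_mul_of_nonneg_left (pw (g1.trans g3) g2 le_rfl) hC₁0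
    have p3 := mul_le_mul_of_nonneg_left (pw g1 g3 g2) hC
    have tri := norm_add₃_le (a := euler T N b σ x₀ w s - eulerDiscrete T N b σ x₀ w n)
      (b := eulerDiscrete T N b σ x₀ w n - eulerDiscrete T N b σ x₀ w (k + 1))
      (c := eulerDiscrete T N b σ x₀ w (k + 1) - euler T N b σ x₀ w r)
    rw [sub_add_sub_cancel, sub_add_sub_cancel] at tri
    have q1 : 0 ≤ (C + C₁ * T ^ α) * (s - r) ^ α := by positivity
    linarith

end Pathwise

/-! ### Hölder continuity from dyadic increments -/

section Dyadic

/-- A continuous function whose dyadic increments of level `n` are at most `K 2 ^ (-α n)` is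
`α`-Hölder. -/
theorem exists_holder_of_dyadic {g : ℝ → ℝ} (hg : ContinuousOn g (Set.Icc 0 1)) {α K : ℝ}
    (hα : 0 < α) (hK : 0 ≤ K)
    (h : ∀ n k : ℕ, k < 2 ^ n →
      |g ((k + 1 : ℕ) / 2 ^ n) - g (k / 2 ^ n)| ≤ K * ((1 / 2 : ℝ) ^ α) ^ n) :
    ∃ C : ℝ, 0 ≤ C ∧ ∀ s ∈ Set.Icc (0 : ℝ) 1, ∀ t ∈ Set.Icc (0 : ℝ) 1,
      |g t - g s| ≤ C * |t - s| ^ α := by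
  set r : ℝ := (1 / 2 : ℝ) ^ α with hr
  have hr0 : 0 < r := by positivity
  have hr1 : r < 1 := Real.rpow_lt_one (by norm_num) (by norm_num) hα
  -- `a n t` is the last dyadic point of level `n` before `t`
  set a : ℕ → ℝ → ℝ := fun n t => (⌊2 ^ n * t⌋₊ : ℝ) / 2 ^ n with ha
  have ha_le : ∀ n t, 0 ≤ t → a n t ≤ t := fun n t ht => by
    rw [ha, div_le_iff₀ (by positivity), mul_comm t]
    exact Nat.floor_le (by positivity)
  have ha_gt : ∀ n t, t - (1 / 2) ^ n < a n t := fun n t => by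
    have : 2 ^ n * t < ⌊2 ^ n * t⌋₊ + 1 := Nat.lt_floor_add_one _
    simp only [ha]
    rw [lt_div_iff₀ (by positivity), sub_mul, ← mul_pow]
    norm_num
    linarith
  have ha0 : ∀ n t, 0 ≤ a n t := fun n t => by positivity
  have hstep : ∀ t ∈ Set.Icc (0 : ℝ) 1, ∀ n, dist (g (a n t)) (g (a (n + 1) t)) ≤ K * r ^ n := by
    rintro t ⟨ht0, ht1⟩ n
    have hle : K * r ^ (n + 1) ≤ K * r ^ n :=
      mul_le_mul_of_nonneg_left (pow_le_pow_of_le_one hr0.le hr1.le n.le_succ) hK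
    set k := ⌊2 ^ n * t⌋₊ with hk
    have e1 : (k : ℝ) ≤ 2 ^ n * t := Nat.floor_le (by positivity)
    have e2 : 2 ^ n * t < k + 1 := Nat.lt_floor_add_one _
    have e3 : a n t = ((2 * k : ℕ) : ℝ) / 2 ^ (n + 1) := by
      simp only [ha, ← hk]; push_cast; field_simp; ring
    have e4 : ⌊2 ^ (n + 1) * t⌋₊ = 2 * k ∨ ⌊2 ^ (n + 1) * t⌋₊ = 2 * k + 1 := by
      have f1 : 2 * k ≤ ⌊2 ^ (n + 1) * t⌋₊ :=
        Nat.le_floor (by push_cast; rw [pow_succ]; linarith)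
      have f2 : ⌊2 ^ (n + 1) * t⌋₊ < 2 * k + 2 :=
        (Nat.floor_lt (by positivity)).2 (by push_cast; rw [pow_succ]; linarith)
      omega
    rcases e4 with e4 | e4
    · have : a (n + 1) t = a n t := by rw [e3]; simp only [ha, e4]
      rw [this, dist_self]; positivity
    · have e5 : a (n + 1) t = ((2 * k + 1 : ℕ) : ℝ) / 2 ^ (n + 1) := by simp only [ha, e4]
      have e6 : 2 * k < 2 ^ (n + 1) := by
        have f1 : ((2 * k + 1 : ℕ) : ℝ) ≤ 2 ^ (n + 1) * t := by
          rw [← e4]; exact Nat.floor_le (by positivity)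
        have f2 : (2 : ℝ) ^ (n + 1) * t ≤ 2 ^ (n + 1) := mul_le_of_le_one_right (by positivity) ht1
        have f3 : 2 * k + 1 ≤ 2 ^ (n + 1) := by exact_mod_cast f1.trans f2
        omega
      rw [e3, e5, dist_comm, Real.dist_eq]
      exact (h (n + 1) (2 * k) e6).trans hle
  have hlim : ∀ t ∈ Set.Icc (0 : ℝ) 1,
      Filter.Tendsto (fun n => g (a n t)) Filter.atTop (nhds (g t)) := by
    rintro t ⟨ht0, ht1⟩
    have e1 : Filter.Tendsto (fun n => a n t) Filter.atTop (nhds t) := by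
      refine tendsto_of_tendsto_of_tendsto_of_le_of_le (g := fun n => t - (1 / 2) ^ n) ?_
        tendsto_const_nhds (fun n => (ha_gt n t).le) (fun n => ha_le n t ht0)
      simpa using tendsto_const_nhds.sub
        (tendsto_pow_atTop_nhds_zero_of_lt_one (by norm_num : (0 : ℝ) ≤ 1 / 2) (by norm_num))
    exact (hg t ⟨ht0, ht1⟩).tendsto.comp (tendsto_nhdsWithin_iff.2
      ⟨e1, Filter.Eventually.of_forall fun n => ⟨ha0 n t, (ha_le n t ht0).trans ht1⟩⟩)
  have happrox : ∀ t ∈ Set.Icc (0 : ℝ) 1, ∀ n, |g (a n t) - g t| ≤ K * r ^ n / (1 - r) :=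
    fun t ht n => dist_le_of_le_geometric_of_tendsto r K hr1 (hstep t ht) (hlim t ht) n
  have hr1' : 0 < 1 - r := by linarith
  refine ⟨(2 * (K / (1 - r)) + K) * 2 ^ α, by positivity, ?_⟩
  have main : ∀ s ∈ Set.Icc (0 : ℝ) 1, ∀ t ∈ Set.Icc (0 : ℝ) 1, s < t →
      |g t - g s| ≤ (2 * (K / (1 - r)) + K) * 2 ^ α * |t - s| ^ α := by
    rintro s ⟨hs0, hs1⟩ t ⟨ht0, ht1⟩ hst
    obtain ⟨n, hn1, hn2⟩ := exists_nat_pow_near_of_lt_one (sub_pos.2 hst)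
      (by linarith : t - s ≤ 1) (by norm_num : (0 : ℝ) < 1 / 2) (by norm_num)
    have hmid : |g (a n t) - g (a n s)| ≤ K * r ^ n := by
      set k := ⌊2 ^ n * s⌋₊ with hk
      have e1 : 2 ^ n * s < k + 1 := Nat.lt_floor_add_one _
      have e2 : (2 : ℝ) ^ n * (t - s) ≤ 1 := by
        calc (2 : ℝ) ^ n * (t - s) ≤ 2 ^ n * (1 / 2) ^ n := by gcongr
          _ = 1 := by rw [← mul_pow]; norm_num
      have e3 : k ≤ ⌊2 ^ n * t⌋₊ := Nat.floor_le_floor (by gcongr)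
      have e4 : ⌊2 ^ n * t⌋₊ < k + 2 :=
        (Nat.floor_lt (by positivity)).2 (by push_cast; linarith)
      have e5 : ⌊2 ^ n * t⌋₊ = k ∨ ⌊2 ^ n * t⌋₊ = k + 1 := by omega
      rcases e5 with e5 | e5
      · have : a n t = a n s := by simp only [ha, e5, ← hk]
        rw [this, sub_self, abs_zero]; positivity
      · have e6 : k < 2 ^ n := by
          have f1 : ((k + 1 : ℕ) : ℝ) ≤ 2 ^ n * t := by
            rw [← e5]; exact Nat.floor_le (by positivity)
          have f2 : (2 : ℝ) ^ n * t ≤ 2 ^ n := mul_le_of_le_one_right (by positivity) ht1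
          have f3 : k + 1 ≤ 2 ^ n := by exact_mod_cast f1.trans f2
          omega
        simp only [ha, e5, ← hk]
        exact h n k e6
    have hrn : r ^ n ≤ 2 ^ α * |t - s| ^ α := by
      rw [abs_of_pos (sub_pos.2 hst), ← Real.mul_rpow (by norm_num) (sub_pos.2 hst).le, hr,
        ← Real.rpow_natCast, ← Real.rpow_mul (by norm_num), mul_comm α,
        Real.rpow_mul (by norm_num), Real.rpow_natCast]
      refine Real.rpow_le_rpow (by positivity) ?_ hα.le
      rw [pow_succ] at hn1; linarith
    have h1 := happrox t ⟨ht0, ht1⟩ n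
    have h2 := happrox s ⟨hs0, hs1⟩ n
    have h3 : |g t - g s| ≤ |g (a n t) - g t| + |g (a n t) - g (a n s)| + |g (a n s) - g s| := by
      rw [abs_sub_comm (g (a n t)) (g t)]
      have := abs_add_three (g t - g (a n t)) (g (a n t) - g (a n s)) (g (a n s) - g s)
      rwa [sub_add_sub_cancel, sub_add_sub_cancel] at this
    calc |g t - g s| ≤ K * r ^ n / (1 - r) + K * r ^ n + K * r ^ n / (1 - r) := by linarith
      _ = (2 * (K / (1 - r)) + K) * r ^ n := by ring
      _ ≤ (2 * (K / (1 - r)) + K) * (2 ^ α * |t - s| ^ α) := by gcongr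
      _ = _ := by ring
  intro s hs t ht
  rcases lt_trichotomy s t with hst | rfl | hst
  · exact main s hs t ht hst
  · simp [Real.zero_rpow hα.ne']
  · rw [abs_sub_comm, abs_sub_comm t s]; exact main t ht s hs hst

end Dyadic

/-! ### Kolmogorov's criterion -/

section Kolmogorov

variable {Ω : Type*} [MeasurableSpace Ω] {P : Measure Ω}

/-- Kolmogorov's Hölder regularity on `[0, 1]` for a process with continuous paths: a bound of
order `|t - s| ^ (H p)` on the `p`-th moments of the increments gives `α`-Hölder paths as soon
as `p (H - α) > 1`. -/
theorem ae_exists_holder_of_moment {X : ℝ → Ω → ℝ} {H α : ℝ} {p : ℕ} {M : ENNReal} (hM : M ≠ ⊤)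
    (hα : 0 < α) (hp : 1 < p * (H - α)) (hmeas : ∀ t, AEMeasurable (X t) P)
    (hcont : ∀ᵐ ω ∂P, ContinuousOn (fun t => X t ω) (Set.Icc 0 1))
    (hmom : ∀ s ∈ Set.Icc (0 : ℝ) 1, ∀ t ∈ Set.Icc (0 : ℝ) 1,
      ∫⁻ ω, ‖X t ω - X s ω‖ₑ ^ p ∂P ≤ ENNReal.ofReal (|t - s| ^ H) ^ p * M) :
    ∀ᵐ ω ∂P, ∃ C : ℝ, 0 ≤ C ∧ ∀ s ∈ Set.Icc (0 : ℝ) 1, ∀ t ∈ Set.Icc (0 : ℝ) 1,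
      |X t ω - X s ω| ≤ C * |t - s| ^ α := by
  have hp0 : p ≠ 0 := by rintro rfl; norm_num at hp
  set F : ℕ → ℕ → Ω → ENNReal := fun n k ω => (ENNReal.ofReal (((2 : ℝ) ^ α) ^ n) *
    ‖X ((k + 1 : ℕ) / 2 ^ n) ω - X (k / 2 ^ n) ω‖ₑ) ^ p with hF
  have hFm : ∀ n k, AEMeasurable (F n k) P := fun n k =>
    ((((hmeas _).sub (hmeas _)).enorm.const_mul _).pow_const p)
  -- the ratio of the geometric series that bounds the expectation
  set q : ℝ := 2 * ((2 : ℝ) ^ (α - H)) ^ p with hq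
  have hq0 : 0 ≤ q := by positivity
  have hq1 : q < 1 := by
    rw [hq, ← Real.rpow_natCast, ← Real.rpow_mul (by norm_num)]
    have : (2 : ℝ) * 2 ^ ((α - H) * p) = 2 ^ (1 + (α - H) * p) := by
      rw [Real.rpow_add (by norm_num), Real.rpow_one]
    rw [this]
    exact Real.rpow_lt_one_of_one_lt_of_neg (by norm_num) (by linarith)
  have hFint : ∀ n, ∀ k ∈ Finset.range (2 ^ n),
      ∫⁻ ω, F n k ω ∂P ≤ ENNReal.ofReal ((((2 : ℝ) ^ (α - H)) ^ p) ^ n) * M := by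
    intro n k hk
    have hk' : ((k + 1 : ℕ) : ℝ) ≤ 2 ^ n := by exact_mod_cast Finset.mem_range.1 hk
    have m1 : ((k + 1 : ℕ) : ℝ) / 2 ^ n ∈ Set.Icc (0 : ℝ) 1 :=
      ⟨by positivity, by rw [div_le_one (by positivity)]; exact hk'⟩
    have m2 : (k : ℝ) / 2 ^ n ∈ Set.Icc (0 : ℝ) 1 :=
      ⟨by positivity, by rw [div_le_one (by positivity)]; push_cast at hk'; linarith⟩
    have hd : |((k + 1 : ℕ) : ℝ) / 2 ^ n - k / 2 ^ n| = (1 / 2) ^ n := by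
      rw [← sub_div]; push_cast
      rw [add_sub_cancel_left, abs_of_pos (by positivity), one_div_pow]
    have e := hmom _ m2 _ m1
    rw [hd] at e
    simp only [hF, mul_pow]
    rw [lintegral_const_mul' _ _ (by finiteness)]
    refine (mul_le_mul_right e _).trans (le_of_eq ?_)
    rw [← mul_assoc, ← mul_pow, ← ENNReal.ofReal_mul (by positivity),
      ← ENNReal.ofReal_pow (by positivity)]
    congr 2
    rw [one_div_pow, one_div, Real.inv_rpow (by positivity), ← Real.rpow_natCast 2 n,
      ← Real.rpow_mul (by norm_num), ← Real.rpow_natCast _ n, ← Real.rpow_mul (by norm_num),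
      ← Real.rpow_neg (by norm_num), ← Real.rpow_add (by norm_num), ← pow_mul, mul_comm p n,
      pow_mul, ← Real.rpow_natCast (2 ^ (α - H)) n, ← Real.rpow_mul (by norm_num)]
    congr 2; ring
  have hsum : ∫⁻ ω, ∑' n, ∑ k ∈ Finset.range (2 ^ n), F n k ω ∂P ≠ ⊤ := by
    rw [lintegral_tsum fun n => Finset.aemeasurable_fun_sum _ fun k _ => hFm n k]
    have e : ∀ n, ∫⁻ ω, ∑ k ∈ Finset.range (2 ^ n), F n k ω ∂P ≤ ENNReal.ofReal (q ^ n) * M := by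
      intro n
      rw [lintegral_finsetSum' _ fun k _ => hFm n k]
      refine (Finset.sum_le_sum (hFint n)).trans (le_of_eq ?_)
      rw [Finset.sum_const, Finset.card_range, nsmul_eq_mul, ← mul_assoc, hq, mul_pow,
        ENNReal.ofReal_mul (by positivity), ENNReal.ofReal_pow (by norm_num : (0 : ℝ) ≤ 2) n]
      simp
    refine ne_top_of_le_ne_top ?_ (ENNReal.tsum_le_tsum e)
    rw [ENNReal.tsum_mul_right]
    exact ENNReal.mul_ne_top (summable_geometric_of_lt_one hq0 hq1).tsum_ofReal_ne_top hM
  have hfin := ae_lt_top' (AEMeasurable.tsum fun n =>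
    Finset.aemeasurable_fun_sum _ fun k _ => hFm n k) hsum
  filter_upwards [hfin, hcont] with ω hω hc
  set S := ∑' n, ∑ k ∈ Finset.range (2 ^ n), F n k ω with hS
  refine exists_holder_of_dyadic hc hα (K := 1 + S.toReal) (by positivity) fun n k hk => ?_
  have h1 : F n k ω ≤ S :=
    (Finset.single_le_sum (f := fun k => F n k ω) (fun _ _ => zero_le)
      (Finset.mem_range.2 hk)).trans (ENNReal.le_tsum n)
  set z := X ((k + 1 : ℕ) / 2 ^ n) ω - X (k / 2 ^ n) ω with hz
  have h2 : (((2 : ℝ) ^ α) ^ n * |z|) ^ p ≤ S.toReal := by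
    have := ENNReal.toReal_mono hω.ne h1
    simpa [hF, ENNReal.toReal_pow, ENNReal.toReal_mul, toReal_enorm, hz,
      ENNReal.toReal_ofReal (show (0 : ℝ) ≤ ((2 : ℝ) ^ α) ^ n by positivity)] using this
  -- `u ^ p ≤ S` forces `u ≤ 1 + S`
  have h3 : ((2 : ℝ) ^ α) ^ n * |z| ≤ 1 + S.toReal := by
    rcases le_total (((2 : ℝ) ^ α) ^ n * |z|) 1 with h | h
    · linarith [S.toReal_nonneg]
    · linarith [le_self_pow₀ h hp0]
  rw [one_div, Real.inv_rpow (by norm_num), inv_pow, ← div_eq_mul_inv, le_div_iff₀ (by positivity),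
    mul_comm]
  exact h3

end Kolmogorov

/-! ### Paths of fractional Brownian motion -/

section FBM

variable {Ω : Type*} [MeasurableSpace Ω] {P : Measure Ω}
  {H : ℝ} {B : ℝ≥0 → Ω → ℝ}

theorem IsFBM.integral_sub_sq (hB : IsFBM P H B) (hH : 0 < H) (s t : ℝ≥0) :
    ∫ ω, (B t ω - B s ω) ^ 2 ∂P = |(t : ℝ) - s| ^ (2 * H) := by
  have hL : ∀ u, MemLp (B u) 2 P := fun u => (hB.gaussian.hasGaussianLaw_eval u).memLp_two
  have i1 : ∀ u v, Integrable (fun ω => B u ω * B v ω) P := fun u v => (hL u).integrable_mul (hL v)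
  have e : ∀ ω, (B t ω - B s ω) ^ 2 = B t ω * B t ω + B s ω * B s ω - 2 * (B t ω * B s ω) :=
    fun ω => by ring
  simp_rw [e]
  rw [integral_sub (f := fun ω => B t ω * B t ω + B s ω * B s ω) ((i1 t t).add (i1 s s))
    ((i1 t s).const_mul 2), integral_add (i1 t t) (i1 s s), integral_const_mul,
    hB.covariance, hB.covariance, hB.covariance]
  simp only [sub_self, abs_zero, Real.zero_rpow (by linarith : 2 * H ≠ 0)]
  ring

theorem IsFBM.map_sub (hB : IsFBM P H B) (hH : 0 < H) (s t : ℝ≥0) :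
    P.map (fun ω => B t ω - B s ω) = (gaussianReal 0 1).map (fun x => |(t : ℝ) - s| ^ H * x) := by
  have hG := hB.gaussian.hasGaussianLaw_fun_sub (s := t) (t := s)
  have hi : ∀ u, Integrable (B u) P := fun u => (hB.gaussian.hasGaussianLaw_eval u).integrable
  have hmean : ∫ ω, (B t ω - B s ω) ∂P = 0 := by
    rw [integral_sub (hi t) (hi s), hB.centered, hB.centered, sub_zero]
  rw [hG.map_eq_gaussianReal, hmean, gaussianReal_map_const_mul, mul_zero,
    variance_of_integral_eq_zero hG.aemeasurable hmean, hB.integral_sub_sq hH]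
  congr 1
  ext
  rw [Real.coe_toNNReal _ (by positivity)]
  simp [← Real.rpow_mul_natCast (abs_nonneg _), mul_comm]

theorem IsFBM.lintegral_enorm_sub_pow (hB : IsFBM P H B) (hH : 0 < H) (p : ℕ) (s t : ℝ≥0) :
    ∫⁻ ω, ‖B t ω - B s ω‖ₑ ^ p ∂P =
      ENNReal.ofReal (|(t : ℝ) - s| ^ H) ^ p * ∫⁻ x, ‖x‖ₑ ^ p ∂(gaussianReal 0 1) := by
  have hm : AEMeasurable (fun ω => B t ω - B s ω) P :=
    (hB.gaussian.aemeasurable t).sub (hB.gaussian.aemeasurable s)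
  calc ∫⁻ ω, ‖B t ω - B s ω‖ₑ ^ p ∂P = ∫⁻ x, ‖x‖ₑ ^ p ∂(P.map fun ω => B t ω - B s ω) :=
        (lintegral_map' (f := fun x => ‖x‖ₑ ^ p) (by fun_prop) hm).symm
    _ = ∫⁻ x, ‖|(t : ℝ) - s| ^ H * x‖ₑ ^ p ∂(gaussianReal 0 1) := by
        rw [hB.map_sub hH, lintegral_map (by fun_prop) (by fun_prop)]
    _ = _ := by
        simp_rw [enorm_mul, mul_pow]
        rw [lintegral_const_mul _ (by fun_prop), Real.enorm_of_nonneg (by positivity)]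

theorem lintegral_enorm_pow_gaussianReal_ne_top (p : ℕ) :
    ∫⁻ x, ‖x‖ₑ ^ p ∂(gaussianReal 0 1) ≠ ⊤ := by
  rcases eq_or_ne p 0 with rfl | hp
  · simp
  have h := (memLp_id_gaussianReal' (μ := 0) (v := 1) (p : ENNReal) (by simp)).2
  rw [eLpNorm_lt_top_iff_lintegral_rpow_enorm_lt_top (by exact_mod_cast hp) (by simp)] at h
  simpa using h.ne

/-- The paths of fractional Brownian motion are `α`-Hölder on `[0, T]` for every `α < H`. -/
theorem IsFBM.ae_exists_holder (hB : IsFBM P H B) {T α : ℝ} (hT : 0 < T) (hα : 0 < α)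
    (hαH : α < H) :
    ∀ᵐ ω ∂P, ∃ K : ℝ, 0 ≤ K ∧ ∀ s ∈ Set.Icc 0 T, ∀ t ∈ Set.Icc 0 T,
      |B t.toNNReal ω - B s.toNNReal ω| ≤ K * |t - s| ^ α := by
  have hH : 0 < H := hα.trans hαH
  obtain ⟨p, hp⟩ := exists_nat_gt (1 / (H - α))
  rw [div_lt_iff₀ (sub_pos.2 hαH)] at hp
  have key := ae_exists_holder_of_moment (P := P) (X := fun u ω => B (T * u).toNNReal ω) (H := H)
    (p := p) (M := ENNReal.ofReal (T ^ H) ^ p * ∫⁻ x, ‖x‖ₑ ^ p ∂(gaussianReal 0 1))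
    (ENNReal.mul_ne_top (by finiteness) (lintegral_enorm_pow_gaussianReal_ne_top p))
    hα hp (fun t => hB.gaussian.aemeasurable _) ?_ ?_
  · filter_upwards [key] with ω ⟨C, hC, h⟩
    refine ⟨C * (1 / T) ^ α, by positivity, fun s hs t ht => ?_⟩
    have mem : ∀ {u}, u ∈ Set.Icc 0 T → u / T ∈ Set.Icc (0 : ℝ) 1 := fun hu =>
      ⟨div_nonneg hu.1 hT.le, (div_le_one hT).2 hu.2⟩
    have e := h _ (mem hs) _ (mem ht)
    rw [mul_div_cancel₀ _ hT.ne', mul_div_cancel₀ _ hT.ne', ← sub_div, abs_div, abs_of_pos hT,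
      div_eq_mul_one_div, Real.mul_rpow (abs_nonneg _) (by positivity)] at e
    linarith
  · filter_upwards [hB.continuous_paths] with ω hω
    exact (hω.comp
      (continuous_real_toNNReal.comp (continuous_const.mul continuous_id))).continuousOn
  · rintro s ⟨hs, -⟩ t ⟨ht, -⟩
    rw [hB.lintegral_enorm_sub_pow hH, Real.coe_toNNReal _ (by positivity),
      Real.coe_toNNReal _ (by positivity), ← mul_sub, abs_mul, abs_of_pos hT,
      Real.mul_rpow hT.le (abs_nonneg _), ENNReal.ofReal_mul (by positivity), mul_pow]
    exact le_of_eq (by ring)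

end FBM

/-! ### Measurability of the approximations and of the bound -/

section Measurability

variable {Ω : Type*} [MeasurableSpace Ω] {P : Measure Ω} {d m : ℕ} {T : ℝ} {N : ℕ}
  {B : Fin m → ℝ≥0 → Ω → ℝ} {X₀ : Ω → Fin d → ℝ} {b : Ω → ℝ → (Fin d → ℝ) → Fin d → ℝ}
  {σ : Ω → ℝ → (Fin d → ℝ) → Matrix (Fin d) (Fin m) ℝ}

theorem aemeasurable_coeff_comp {f : Ω → ℝ → (Fin d → ℝ) → ℝ}
    (hf : Measurable fun p : Ω × Set.Icc (0 : ℝ) T × (Fin d → ℝ) => f p.1 (p.2.1 : ℝ) p.2.2)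
    {t : ℝ} (ht : t ∈ Set.Icc 0 T) {y : Ω → Fin d → ℝ} (hy : AEMeasurable y P) :
    AEMeasurable (fun ω => f ω t (y ω)) P :=
  hf.comp_aemeasurable
    (f := fun ω => ((ω, (⟨t, ht⟩, y ω)) : Ω × Set.Icc (0 : ℝ) T × (Fin d → ℝ)))
    (aemeasurable_id.prodMk (aemeasurable_const.prodMk hy))

theorem aemeasurable_eulerDiscrete (hT : 0 < T) (hN : 0 < N)
    (hB : ∀ j t, AEMeasurable (B j t) P) (hX₀ : AEMeasurable X₀ P)
    (hb : ∀ i, Measurable fun p : Ω × Set.Icc (0 : ℝ) T × (Fin d → ℝ) =>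
      b p.1 (p.2.1 : ℝ) p.2.2 i)
    (hσ : ∀ i j, Measurable fun p : Ω × Set.Icc (0 : ℝ) T × (Fin d → ℝ) =>
      σ p.1 (p.2.1 : ℝ) p.2.2 i j) {n : ℕ} (hn : n ≤ N) :
    AEMeasurable (fun ω => eulerDiscrete T N (b ω) (σ ω) (X₀ ω) (fun j s => B j s ω) n) P := by
  induction n with
  | zero => exact hX₀
  | succ n ih =>
    have hy := ih (by omega)
    have hg := grid_mem_Icc hT hN (by omega : n ≤ N)
    refine aemeasurable_pi_lambda _ fun i => ?_
    simp only [eulerDiscrete]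
    refine (((aemeasurable_pi_iff.1 hy i).add
      ((aemeasurable_coeff_comp (f := fun ω t x => b ω t x i) (hb i) hg hy).mul_const _)).add ?_)
    exact Finset.aemeasurable_fun_sum _ fun j _ =>
      (aemeasurable_coeff_comp (f := fun ω t x => σ ω t x i j) (hσ i j) hg hy).mul
        ((hB j _).sub (hB j _))

theorem aemeasurable_euler (hT : 0 < T) (hN : 0 < N)
    (hB : ∀ j t, AEMeasurable (B j t) P) (hX₀ : AEMeasurable X₀ P)
    (hb : ∀ i, Measurable fun p : Ω × Set.Icc (0 : ℝ) T × (Fin d → ℝ) =>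
      b p.1 (p.2.1 : ℝ) p.2.2 i)
    (hσ : ∀ i j, Measurable fun p : Ω × Set.Icc (0 : ℝ) T × (Fin d → ℝ) =>
      σ p.1 (p.2.1 : ℝ) p.2.2 i j) {t : ℝ} (ht : t ≤ T) :
    AEMeasurable (fun ω => euler T N (b ω) (σ ω) (X₀ ω) (fun j s => B j s ω) t) P := by
  have hn := gridIndex_le hT hN ht
  have hy := aemeasurable_eulerDiscrete hT hN hB hX₀ hb hσ hn
  have hg := grid_mem_Icc hT hN hn
  refine aemeasurable_pi_lambda _ fun i => ?_
  simp only [euler]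
  refine (((aemeasurable_pi_iff.1 hy i).add
    ((aemeasurable_coeff_comp (f := fun ω t x => b ω t x i) (hb i) hg hy).mul_const _)).add ?_)
  exact Finset.aemeasurable_fun_sum _ fun j _ =>
    (aemeasurable_coeff_comp (f := fun ω t x => σ ω t x i j) (hσ i j) hg hy).mul
      ((hB j _).sub (hB j _))

/-- A countable family of random variables that is almost surely bounded above has a measurable
upper bound. -/
theorem exists_measurable_bound {ι : Type*} [Countable ι] {f : ι → Ω → ℝ}
    (hf : ∀ i, AEMeasurable (f i) P) (h : ∀ᵐ ω ∂P, ∃ C, ∀ i, f i ω ≤ C) :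
    ∃ C : Ω → ℝ, Measurable C ∧ ∀ᵐ ω ∂P, ∀ i, f i ω ≤ C ω := by
  have hG : AEMeasurable (fun ω => ⨆ i, ENNReal.ofReal (f i ω)) P :=
    AEMeasurable.iSup fun i => (hf i).ennreal_ofReal
  refine ⟨fun ω => (hG.mk _ ω).toReal, hG.measurable_mk.ennreal_toReal, ?_⟩
  filter_upwards [h, hG.ae_eq_mk] with ω ⟨C, hC⟩ hω i
  rw [← hω]
  have hfin : ⨆ i, ENNReal.ofReal (f i ω) ≠ ⊤ :=
    ne_top_of_le_ne_top ENNReal.ofReal_ne_top (iSup_le fun i => ENNReal.ofReal_le_ofReal (hC i))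
  exact (ENNReal.ofReal_le_iff_le_toReal hfin).1 (le_iSup (fun i => ENNReal.ofReal (f i ω)) i)

theorem continuous_vecAbs : Continuous (vecAbs : (Fin d → ℝ) → ℝ) := by
  unfold vecAbs; fun_prop

/-- If for almost every `ω` the paths `Y N · ω`, `N ≥ 1`, admit a common bound and Hölder constant,
then that constant can be chosen measurable: it suffices to control countably many times. -/
theorem exists_measurable_holder_bound (hT : 0 ≤ T) {c : ℝ} (hc : 0 < c)
    {Y : ℕ → ℝ → Ω → Fin d → ℝ}
    (hmeas : ∀ N, 0 < N → ∀ t ∈ Set.Icc 0 T, AEMeasurable (Y N t) P)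
    (hY : ∀ᵐ ω ∂P, ∃ C : ℝ, ∀ N, 0 < N → ∀ s ∈ Set.Icc 0 T, ∀ t ∈ Set.Icc 0 T,
      vecAbs (Y N t ω) ≤ C ∧ vecAbs (Y N t ω - Y N s ω) ≤ C * |t - s| ^ c) :
    ∃ C : Ω → ℝ, Measurable C ∧ ∀ᵐ ω ∂P, ∀ N, 0 < N → ∀ s ∈ Set.Icc 0 T, ∀ t ∈ Set.Icc 0 T,
      vecAbs (Y N t ω) ≤ C ω ∧ vecAbs (Y N t ω - Y N s ω) ≤ C ω * |t - s| ^ c := by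
  have : Nonempty (Set.Icc 0 T) := ⟨⟨0, le_rfl, hT⟩⟩
  set e := TopologicalSpace.denseSeq (Set.Icc 0 T) with he
  have hpow : ∀ k l, e k ≠ e l → 0 < |(e l : ℝ) - e k| ^ c := fun k l hkl =>
    Real.rpow_pos_of_pos (abs_pos.2 (sub_ne_zero.2 fun h => hkl (Subtype.ext h.symm))) _
  have hvec : Measurable (vecAbs : (Fin d → ℝ) → ℝ) := continuous_vecAbs.measurable
  -- at `e k = e l` the quotient is `0`
  obtain ⟨C, hCm, hC⟩ := exists_measurable_bound (P := P)
    (f := fun (z : ℕ × ℕ × ℕ) ω => max (vecAbs (Y (z.1 + 1) (e z.2.2) ω))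
      (vecAbs (Y (z.1 + 1) (e z.2.2) ω - Y (z.1 + 1) (e z.2.1) ω) /
        |(e z.2.2 : ℝ) - e z.2.1| ^ c))
    (fun z => (hvec.comp_aemeasurable (hmeas _ z.1.succ_pos _ (e _).2)).max
      ((hvec.comp_aemeasurable ((hmeas _ z.1.succ_pos _ (e _).2).sub
        (hmeas _ z.1.succ_pos _ (e _).2))).div_const _))
    (by
      filter_upwards [hY] with ω ⟨C, hC⟩
      refine ⟨C, fun ⟨n, k, l⟩ => ?_⟩
      obtain ⟨h1, h2⟩ := hC (n + 1) n.succ_pos (e k) (e k).2 (e l) (e l).2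
      refine max_le h1 ?_
      by_cases hkl : e k = e l
      · have h0 : 0 ≤ C := le_trans (Finset.sum_nonneg fun _ _ => abs_nonneg _) h1
        simpa [hkl, vecAbs] using h0
      · exact (div_le_iff₀ (hpow k l hkl)).2 h2)
  refine ⟨C, hCm, ?_⟩
  filter_upwards [hY, hC] with ω ⟨C₀, hC₀⟩ hω N hN
  have hcont : Continuous fun t : Set.Icc 0 T => Y N t ω := by
    refine continuous_iff_continuousAt.2 fun s => tendsto_iff_norm_sub_tendsto_zero.2 ?_
    refine squeeze_zero (fun _ => norm_nonneg _)
      (fun t => (norm_le_vecAbs _).trans (hC₀ N hN s s.2 t t.2).2) ?_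
    have : Continuous fun t : Set.Icc 0 T => C₀ * |(t : ℝ) - s| ^ c := by
      have := Real.continuous_rpow_const hc.le
      fun_prop
    simpa [Real.zero_rpow hc.ne'] using this.tendsto s
  have key : ∀ s t : Set.Icc 0 T,
      vecAbs (Y N t ω) ≤ C ω ∧ vecAbs (Y N t ω - Y N s ω) ≤ C ω * |(t : ℝ) - s| ^ c := by
    refine isClosed_property2 (e := e) (TopologicalSpace.denseRange_denseSeq _) ?_ fun k l => ?_
    · have h1 : Continuous fun z : Set.Icc 0 T × Set.Icc 0 T => Y N z.1 ω :=
        hcont.comp continuous_fst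
      have h2 : Continuous fun z : Set.Icc 0 T × Set.Icc 0 T => Y N z.2 ω :=
        hcont.comp continuous_snd
      have h3 := Real.continuous_rpow_const hc.le
      exact (isClosed_le (continuous_vecAbs.comp h2) continuous_const).inter
        (isClosed_le (continuous_vecAbs.comp (h2.sub h1)) (by fun_prop))
    · have h := hω (N - 1, k, l)
      simp only [Nat.sub_add_cancel hN] at h
      refine ⟨(le_max_left _ _).trans h, ?_⟩
      by_cases hkl : e k = e l
      · simp [hkl, vecAbs, Real.zero_rpow hc.ne']
      · exact (div_le_iff₀ (hpow k l hkl)).1 ((le_max_right _ _).trans h)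
  exact fun s hs t ht => key ⟨s, hs⟩ ⟨t, ht⟩

end Measurability

/-! ### Conditions on the coefficients -/

section Conditions

variable {d m : ℕ} {T M β : ℝ} {b : ℝ → (Fin d → ℝ) → Fin d → ℝ}
  {σ : ℝ → (Fin d → ℝ) → Matrix (Fin d) (Fin m) ℝ}

theorem HolderInTime.matAbs_sub_le (h : HolderInTime T M β σ) (hM : 0 ≤ M) :
    ∀ t ∈ Set.Icc 0 T, ∀ s ∈ Set.Icc 0 T, ∀ x, matAbs (σ t x - σ s x) ≤ M * |t - s| ^ β := by
  intro t ht s hs x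
  -- in dimension zero there is no direction `k` to which the hypothesis could be applied
  rcases Nat.eq_zero_or_pos d with rfl | hd
  · have : 0 ≤ M * |t - s| ^ β := by positivity
    simpa [matAbs] using this
  · exact (le_add_of_nonneg_right (matAbs_nonneg _)).trans (h t ht s hs ⟨0, hd⟩ x)

/-- The properties of the coefficients on which the bounds depend: `σ` is Lipschitz in space and
`β`-Hölder in time with `β > 1 - H`, and `b` and `σ` grow at most linearly. -/
def LinearGrowthCoeffs (T H : ℝ) (b : ℝ → (Fin d → ℝ) → Fin d → ℝ)
    (σ : ℝ → (Fin d → ℝ) → Matrix (Fin d) (Fin m) ℝ) : Prop :=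
  ∃ M β L : ℝ, 0 ≤ M ∧ 1 - H < β ∧ 0 ≤ L ∧ LipInSpace T M σ ∧
    (∀ t ∈ Set.Icc 0 T, ∀ s ∈ Set.Icc 0 T, ∀ x, matAbs (σ t x - σ s x) ≤ M * |t - s| ^ β) ∧
    (∀ t ∈ Set.Icc 0 T, ∀ x, vecAbs (b t x) ≤ L * (1 + vecAbs x)) ∧
    ∀ t ∈ Set.Icc 0 T, ∀ x, matAbs (σ t x) ≤ L * (1 + vecAbs x)

theorem linearGrowthCoeffs_of_condA {H : ℝ} (hA : CondA T H σ) (hB : CondB T b)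
    (hC : CondC T σ) : LinearGrowthCoeffs T H b σ := by
  obtain ⟨-, M, β, κ, hM, hβ, -, -, -, hLip, -, hTime⟩ := hA
  obtain ⟨-, L, hL⟩ := hB
  obtain ⟨K, hK⟩ := hC
  refine ⟨M, β, max 0 (max L K), hM.le, hβ, le_max_left _ _, hLip, hTime.matAbs_sub_le hM.le,
    fun t ht x => (hL t ht x).trans ?_, fun t ht x => (hK t ht x).trans ?_⟩
  all_goals
    have := vecAbs_nonneg x
    gcongr
    simp

theorem linearGrowthCoeffs_of_bounded {H : ℝ} (hA : CondAWithout2 T H σ)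
    (hb : BoundedCoeffs T b σ) : LinearGrowthCoeffs T H b σ := by
  obtain ⟨-, M, β, hM, hβ, -, hLip, hTime⟩ := hA
  obtain ⟨K, hK⟩ := hb
  have h : ∀ x : Fin d → ℝ, K ≤ |K| * (1 + vecAbs x) := fun x =>
    (le_abs_self K).trans (le_mul_of_one_le_right (abs_nonneg K) (by linarith [vecAbs_nonneg x]))
  exact ⟨M, β, |K|, hM.le, hβ, abs_nonneg K, hLip, hTime.matAbs_sub_le hM.le,
    fun t ht x => (hK t ht x).1.trans (h x), fun t ht x => (hK t ht x).2.trans (h x)⟩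

end Conditions

/-! ### The almost sure bound -/

section Main

variable {Ω : Type*} [MeasurableSpace Ω] {P : Measure Ω} {d m : ℕ} {T H : ℝ}
  {B : Fin m → ℝ≥0 → Ω → ℝ}

/-- Almost surely, all driving paths are `q`-Hölder for every rational `q < H` simultaneously. -/
theorem ae_forall_exists_holder (hT : 0 < T) (hB : ∀ j, IsFBM P H (B j)) :
    ∀ᵐ ω ∂P, ∀ q : ℚ, 0 < (q : ℝ) → (q : ℝ) < H → ∃ K : ℝ, 0 ≤ K ∧
      ∀ j, ∀ s ∈ Set.Icc 0 T, ∀ t ∈ Set.Icc 0 T,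
        |B j t.toNNReal ω - B j s.toNNReal ω| ≤ K * |t - s| ^ (q : ℝ) := by
  have h : ∀ q : ℚ, ∀ j, ∀ᵐ ω ∂P, 0 < (q : ℝ) → (q : ℝ) < H → ∃ K : ℝ, 0 ≤ K ∧
      ∀ s ∈ Set.Icc 0 T, ∀ t ∈ Set.Icc 0 T,
        |B j t.toNNReal ω - B j s.toNNReal ω| ≤ K * |t - s| ^ (q : ℝ) := by
    intro q j
    by_cases hq : 0 < (q : ℝ) ∧ (q : ℝ) < H
    · filter_upwards [(hB j).ae_exists_holder hT hq.1 hq.2] with ω hω _ _ using hω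
    · exact Filter.Eventually.of_forall fun ω h1 h2 => (hq ⟨h1, h2⟩).elim
  filter_upwards [ae_all_iff.2 fun q => ae_all_iff.2 (h q)] with ω hω q hq0 hqH
  choose K hK0 hK using fun j => hω q j hq0 hqH
  refine ⟨∑ j, K j, Finset.sum_nonneg fun j _ => hK0 j, fun j s hs t ht => ?_⟩
  refine (hK j s hs t ht).trans ?_
  gcongr
  exact Finset.single_le_sum (fun j _ => hK0 j) (Finset.mem_univ j)

/-- If the driving path is `q`-Hölder for every rational `q < H`, then all Euler approximations
share one bound and one `c`-Hölder constant on `[0, T]`, for any `c < H`. -/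
theorem exists_vecAbs_euler_bound (hT : 0 < T) (hH : 1 / 2 < H) (hH' : H < 1) {c : ℝ}
    (hcH : c < H) {b : ℝ → (Fin d → ℝ) → Fin d → ℝ}
    {σ : ℝ → (Fin d → ℝ) → Matrix (Fin d) (Fin m) ℝ} (hcoef : LinearGrowthCoeffs T H b σ)
    (x₀ : Fin d → ℝ) {w : Fin m → ℝ≥0 → ℝ}
    (hw : ∀ q : ℚ, 0 < (q : ℝ) → (q : ℝ) < H → ∃ K : ℝ, 0 ≤ K ∧
      ∀ j, ∀ s ∈ Set.Icc 0 T, ∀ t ∈ Set.Icc 0 T,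
        |w j t.toNNReal - w j s.toNNReal| ≤ K * |t - s| ^ (q : ℝ)) :
    ∃ C : ℝ, ∀ N, 0 < N → ∀ s ∈ Set.Icc 0 T, ∀ t ∈ Set.Icc 0 T,
      vecAbs (euler T N b σ x₀ w t) ≤ C ∧
      vecAbs (euler T N b σ x₀ w t - euler T N b σ x₀ w s) ≤ C * |t - s| ^ c := by
  obtain ⟨M, β, L, hM, hβ, hL, hLip, hTime, hbL, hσL⟩ := hcoef
  obtain ⟨q, hq, hqH⟩ := exists_rat_btwn
    (show max (max (1 / 2) (1 - β)) c < H from max_lt (max_lt hH (by linarith)) hcH)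
  obtain ⟨⟨hq2, hqβ⟩, hqc⟩ : ((1 : ℝ) / 2 < q ∧ 1 - β < q) ∧ c < q := by
    simpa only [max_lt_iff] using hq
  obtain ⟨K, hK, hwK⟩ := hw q (by linarith) hqH
  obtain ⟨C, hC, h⟩ := exists_bound_euler (x₀ := x₀) hT hM hL hK (by linarith : (q : ℝ) ≤ 1) hq2
    (by linarith) hLip hTime hbL hσL hwK
  have main : ∀ N, 0 < N → ∀ s t, 0 ≤ s → s ≤ t → t ≤ T →
      vecAbs (euler T N b σ x₀ w t - euler T N b σ x₀ w s) ≤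
        d * C * T ^ ((q : ℝ) - c) * |t - s| ^ c := by
    intro N hN s t hs hst ht
    rw [abs_of_nonneg (sub_nonneg.2 hst)]
    have hx : (t - s) ^ (q : ℝ) ≤ T ^ ((q : ℝ) - c) * (t - s) ^ c := by
      rcases hst.eq_or_lt with rfl | hlt
      · rw [sub_self, Real.zero_rpow (by linarith)]
        positivity
      · have hpos : 0 < t - s := sub_pos.2 hlt
        calc (t - s) ^ (q : ℝ) = (t - s) ^ ((q : ℝ) - c) * (t - s) ^ c := by
              rw [← Real.rpow_add hpos]; simp
          _ ≤ _ := by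
              gcongr
              linarith
    calc _ ≤ d * ‖euler T N b σ x₀ w t - euler T N b σ x₀ w s‖ := vecAbs_le_mul_norm _
      _ ≤ d * (C * (T ^ ((q : ℝ) - c) * (t - s) ^ c)) := by
          gcongr
          exact ((h N hN).2 s t hs hst ht).trans (by gcongr)
      _ = _ := by ring
  have hTq : 0 ≤ T ^ ((q : ℝ) - c) := by positivity
  have h0 : 0 ≤ d * C := by positivity
  have h1 : 0 ≤ d * C * T ^ ((q : ℝ) - c) := by positivity
  refine ⟨d * C + d * C * T ^ ((q : ℝ) - c), fun N hN s hs t ht => ⟨?_, ?_⟩⟩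
  · have := (vecAbs_le_mul_norm (euler T N b σ x₀ w t)).trans
      (mul_le_mul_of_nonneg_left ((h N hN).1 t ht) d.cast_nonneg)
    linarith
  · have h2 : vecAbs (euler T N b σ x₀ w t - euler T N b σ x₀ w s) ≤
        d * C * T ^ ((q : ℝ) - c) * |t - s| ^ c := by
      rcases le_total s t with hst | hst
      · exact main N hN s t hs.1 hst ht.2
      · have := main N hN t s ht.1 hst hs.2
        rw [abs_sub_comm]
        simpa only [vecAbs, Pi.sub_apply, abs_sub_comm] using this
    refine h2.trans ?_
    gcongr
    linarith

theorem exists_measurable_euler_bound (hT : 0 < T) (hH : 1 / 2 < H) (hH' : H < 1)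
    (hB : ∀ j, IsFBM P H (B j)) {X₀ : Ω → Fin d → ℝ} (hX₀ : Measurable X₀)
    {b : Ω → ℝ → (Fin d → ℝ) → Fin d → ℝ}
    (hb : ∀ i, Measurable fun p : Ω × Set.Icc (0 : ℝ) T × (Fin d → ℝ) =>
      b p.1 (p.2.1 : ℝ) p.2.2 i)
    {σ : Ω → ℝ → (Fin d → ℝ) → Matrix (Fin d) (Fin m) ℝ}
    (hσ : ∀ i j, Measurable fun p : Ω × Set.Icc (0 : ℝ) T × (Fin d → ℝ) =>
      σ p.1 (p.2.1 : ℝ) p.2.2 i j)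
    {Y : ℕ → ℝ → Ω → Fin d → ℝ}
    (hY : ∀ N t ω, Y N t ω = euler T N (b ω) (σ ω) (X₀ ω) (fun j s => B j s ω) t)
    (hcoef : ∀ᵐ ω ∂P, LinearGrowthCoeffs T H (b ω) (σ ω)) {c : ℝ} (hc : 0 < c) (hcH : c < H) :
    ∃ C : Ω → ℝ, Measurable C ∧ ∀ᵐ ω ∂P, ∀ N, 0 < N → ∀ s ∈ Set.Icc 0 T, ∀ t ∈ Set.Icc 0 T,
      vecAbs (Y N t ω) ≤ C ω ∧ vecAbs (Y N t ω - Y N s ω) ≤ C ω * |t - s| ^ c := by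
  refine exists_measurable_holder_bound hT.le hc (fun N hN t ht => ?_) ?_
  · rw [show Y N t = fun ω => euler T N (b ω) (σ ω) (X₀ ω) (fun j s => B j s ω) t from
      funext (hY N t)]
    exact aemeasurable_euler hT hN (fun j => (hB j).gaussian.aemeasurable) hX₀.aemeasurable hb hσ
      ht.2
  · filter_upwards [hcoef, ae_forall_exists_holder hT hB] with ω hω hw
    simp only [hY]
    exact exists_vecAbs_euler_bound hT hH hH' hcH hω (X₀ ω) hw

end Main

end EulerFBM

theorem theorem1 {Ω : Type*} [MeasurableSpace Ω] (P : Measure Ω) [IsProbabilityMeasure P]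
    (d m : ℕ) (T H : ℝ) (hT : 0 < T) (hH : 1 / 2 < H) (hH' : H < 1)
    (B : Fin m → ℝ≥0 → Ω → ℝ) (hB : ∀ j, EulerFBM.IsFBM P H (B j))
    (X₀ : Ω → Fin d → ℝ) (hX₀ : Measurable X₀)
    (b : Ω → ℝ → (Fin d → ℝ) → Fin d → ℝ)
    (hb : ∀ i, Measurable fun p : Ω × Set.Icc (0 : ℝ) T × (Fin d → ℝ) =>
      b p.1 (p.2.1 : ℝ) p.2.2 i)
    (σ : Ω → ℝ → (Fin d → ℝ) → Matrix (Fin d) (Fin m) ℝ)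
    (hσ : ∀ i j, Measurable fun p : Ω × Set.Icc (0 : ℝ) T × (Fin d → ℝ) =>
      σ p.1 (p.2.1 : ℝ) p.2.2 i j)
    (Y : ℕ → ℝ → Ω → Fin d → ℝ)
    (hY : ∀ N t ω, Y N t ω = EulerFBM.euler T N (b ω) (σ ω) (X₀ ω) (fun j s => B j s ω) t) :
    ((∀ᵐ ω ∂P, EulerFBM.CondA T H (σ ω) ∧ EulerFBM.CondB T (b ω) ∧ EulerFBM.CondC T (σ ω)) →
      ∀ ε : ℝ, 0 < ε → ∀ ρ : ℝ, 0 < ρ → ρ < H →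
        ∃ δ₀ : ℝ, 0 < δ₀ ∧ ∃ E : Set Ω, MeasurableSet E ∧ 1 - ε < P.real E ∧
          ∃ C : Ω → ℝ, Measurable C ∧
            ∀ ω ∈ E, ∀ N : ℕ, 0 < N → EulerFBM.step T N < δ₀ →
              (∀ t ∈ Set.Icc 0 T, EulerFBM.vecAbs (Y N t ω) ≤ C ω) ∧
              (∀ r s : ℝ, 0 ≤ r → r < s → s ≤ T →
                EulerFBM.vecAbs
                    (Y N (EulerFBM.lastGrid T N s) ω - Y N (EulerFBM.lastGrid T N r) ω) ≤
                  C ω * (EulerFBM.lastGrid T N s - EulerFBM.lastGrid T N r) ^ (H - ρ))) ∧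
    ((∀ᵐ ω ∂P, EulerFBM.CondAWithout2 T H (σ ω) ∧ EulerFBM.CondB T (b ω) ∧
        EulerFBM.BoundedCoeffs T (b ω) (σ ω)) →
      ∀ ρ : ℝ, 0 < ρ → ρ < H →
        ∃ C : Ω → ℝ, Measurable C ∧
          ∀ᵐ ω ∂P, ∀ N : ℕ, 0 < N →
            (∀ t ∈ Set.Icc 0 T, EulerFBM.vecAbs (Y N t ω) ≤ C ω) ∧
            (∀ r s : ℝ, 0 ≤ r → r < s → s ≤ T →
              EulerFBM.vecAbs (Y N s ω - Y N r ω) ≤ C ω * (s - r) ^ (H - ρ))) := by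
  constructor
  · intro hcoef ε hε ρ hρ hρH
    obtain ⟨C, hCm, hC⟩ := EulerFBM.exists_measurable_euler_bound hT hH hH' hB hX₀ hb hσ hY
      (hcoef.mono fun ω h => EulerFBM.linearGrowthCoeffs_of_condA h.1 h.2.1 h.2.2)
      (sub_pos.2 hρH) (sub_lt_self H hρ)
    -- the bound holds for all steps on an event of full measure, so `δ₀` is arbitrary
    obtain ⟨E, hE, hEm, hPE⟩ := exists_measurable_superset_of_null (mem_ae_iff.1 hC)
    refine ⟨1, one_pos, Eᶜ, hEm.compl, ?_, C, hCm, fun ω hω N hN _ => ?_⟩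
    · rw [probReal_compl_eq_one_sub hEm, measureReal_def, hPE]
      simpa using hε
    · have h := not_not.1 fun hn => hω (hE hn)
      refine ⟨fun t ht => (h N hN t ht t ht).1, fun r s hr hrs hs => ?_⟩
      rw [← abs_of_nonneg (sub_nonneg.2 (EulerFBM.lastGrid_mono hT hN hrs.le))]
      exact (h N hN _ (EulerFBM.lastGrid_mem_Icc hT hN (hrs.le.trans hs)) _
        (EulerFBM.lastGrid_mem_Icc hT hN hs)).2
  · intro hcoef ρ hρ hρH
    obtain ⟨C, hCm, hC⟩ := EulerFBM.exists_measurable_euler_bound hT hH hH' hB hX₀ hb hσ hY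
      (hcoef.mono fun ω h => EulerFBM.linearGrowthCoeffs_of_bounded h.1 h.2.2)
      (sub_pos.2 hρH) (sub_lt_self H hρ)
    refine ⟨C, hCm, hC.mono fun ω h N hN => ⟨fun t ht => (h N hN t ht t ht).1,
      fun r s hr hrs hs => ?_⟩⟩
    rw [← abs_of_pos (sub_pos.2 hrs)]
    exact (h N hN r ⟨hr, hrs.le.trans hs⟩ s ⟨hr.trans hrs.le, hs⟩).2
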